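/- A Pick function is a holomorphic function $\Phi$ on $\mathbb C\setminus\mathbb R$ with $\operatorname{Im}\Phi(z)/\operatorname{Im}z\ge 0$ for all $z\in\mathbb C\setminus\mathbb R$ and $\Phi(z)=\overline{\Phi(\overline z)}$ for $\operatorname{Im}z<0$. Let $\mathbb H=\{z:\operatorname{Im}z>0\}$. For a non-decreasing $\nu:\mathbb R\to\mathbb R$, write $d\nu$ for its Lebesgue–Stieltjes measure, $\nu(x\pm0)$ for its one-sided limits, and $\nu(-\infty)=\lim_{t\to-\infty}\nu(t)$. **1.** Let $\Phi$ be a function on $\mathbb C\setminus\mathbb R$. Then $\Phi$ and $\Phi'$ are both Pick functions (in particular $\Phi$ is holomorphic) if and only if there are $\alpha\ge0$, $\beta\in\mathbb R$ and a non-negative non-decreasing function $\nu$ on $\mathbb R$ with $$\int_1^{+\infty}\frac{\nu(t)}{t^2}\,dt<+\infty\qquad(\mathrm a)$$ such that $$\Phi(z)=\alpha z+\beta+\int_{-\infty}^{+\infty}\Big(\frac1{t-z}-\frac t{1+t^2}\Big)\nu(t)\,dt,\qquad z\in\mathbb C\setminus\mathbb R,\qquad(\mathrm b)$$ or, what is the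 same, such that $\Phi(z)=\overline{\Phi(\overline z)}$ for $\operatorname{Im}z<0$ and $$\Phi(z)=\alpha z+\beta+i\pi\nu(-\infty)+\int_{-\infty}^{+\infty}\log\frac{\sqrt{1+t^2}}{t-z}\,d\nu(t),\qquad z\in\mathbb H,\qquad(\mathrm c)$$ with the principal branch of the logarithm. For every non-negative non-decreasing $\nu$ satisfying (a), one has $\int_{[1,\infty)}t^{-1}\,d\nu(t)<+\infty$, the integrals in (b) and (c) converge absolutely, and for the same $\alpha,\beta,\nu$ the right-hand sides of (b) and (c) agree on $\mathbb H$. Both representations are unique if non-decreasing functions that are equal almost everywhere are identified: two triples $(\alpha_1,\beta_1,\nu_1)$, $(\alpha_2,\beta_2,\nu_2)$ as above give the same function in (b) (respectively in (c)) if and only if $\alpha_1=\alpha_2$, $\beta_1=\beta_2$ and $\nu_1=\nu_2$ almost everywhere. **2.** Let $\Phi$ be represented by $\alpha,\beta,\nu$ as in part 1. Then for all $x\in\mathbb R$ and $y>0$, with all integrals absolutely convergent, $$\operatorname{Re}\Phi(x+iy)=\alpha x+\beta+\int_{-\infty}^{+\infty}\Big(\frac{t-x}{y^2+(x-t)^2}-\frac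 t{1+t^2}\Big)\nu(t)\,dt=\alpha x+\beta+\int_{-\infty}^{+\infty}\log\sqrt{\frac{1+t^2}{y^2+(t-x)^2}}\,d\nu(t),$$ $$\operatorname{Im}\Phi(x+iy)=\alpha y+\int_{-\infty}^{+\infty}\frac{y}{y^2+(x-t)^2}\,\nu(t)\,dt=\alpha y+\pi\nu(-\infty)+\int_{-\infty}^{+\infty}\Big(\frac\pi2-\arctan\frac{t-x}y\Big)d\nu(t).$$ For almost all $x\in\mathbb R$, the function $t\mapsto\log\frac{\sqrt{1+t^2}}{|t-x|}$ (with value $+\infty$ at $t=x$) is in $L_1(\mathbb R,d\nu)$, and $\operatorname{Re}\Phi(z)$ has, as $z\in\mathbb H$ tends to $x$ non-tangentially, the finite limit $$\alpha x+\beta+\int_{-\infty}^{+\infty}\log\frac{\sqrt{1+t^2}}{|t-x|}\,d\nu(t).$$ For every $x\in\mathbb R$ the limit $\lim_{y\downarrow0}\operatorname{Im}\Phi(x+iy)$ exists and is finite, and it equals $\pi\nu(x)$ for every $x$ provided that $\nu(x)=\frac12\big(\nu(x+0)+\nu(x-0)\big)$ for every $x\in\mathbb R$. Finally, if $\operatorname{Im}\Phi(z)$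 has a finite limit as $z\in\mathbb H$ tends to $x$ non-tangentially, then $\nu(x-0)=\nu(x+0)$. -/

import Mathlib

open MeasureTheory Filter Set Topology ComplexConjugate

namespace Pick

/-- The symmetry `Φ(z) = conj (Φ (conj z))` by which a function on the upper half-plane is extended
to the lower one. -/
def ReflectionSymmetric (Φ : ℂ → ℂ) : Prop :=
  ∀ z : ℂ, z.im < 0 → Φ z = conj (Φ (conj z))

/-- The class `𝒫` of Pick functions: holomorphic functions on `ℂ ∖ ℝ`, with `Im Φ(z) / Im z ≥ 0`,
symmetric under reflection. The values that the total function `Φ : ℂ → ℂ` takes on the real axis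
play no role. -/
structure IsPick (Φ : ℂ → ℂ) : Prop where
  holo : DifferentiableOn ℂ Φ {z : ℂ | z.im ≠ 0}
  im_div_im_nonneg : ∀ z : ℂ, z.im ≠ 0 → 0 ≤ (Φ z).im / z.im
  symm : ReflectionSymmetric Φ

/-- The class of Pick functions whose derivative is again a Pick function. -/
def primClass : Set (ℂ → ℂ) := {Φ | IsPick Φ ∧ IsPick (deriv Φ)}

/-- The non-negative non-decreasing functions `ν` on `ℝ` with `∫_1^∞ ν(t) / t² dt < ∞`. -/
structure IsWeight (ν : ℝ → ℝ) : Prop where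
  nonneg : ∀ t, 0 ≤ ν t
  mono : Monotone ν
  integrable : IntegrableOn (fun t : ℝ => ν t / t ^ 2) (Ioi 1)

/-- The Lebesgue–Stieltjes measure `dν` of a non-decreasing function `ν`; it gives `(a, b]` the mass
`ν(b+0) - ν(a+0)`. -/
noncomputable def lsMeasure (ν : ℝ → ℝ) (hν : Monotone ν) : Measure ℝ :=
  hν.stieltjesFunction.measure

/-- `ν(-∞)`, the limit of `ν` at `-∞`. -/
noncomputable def negInf (ν : ℝ → ℝ) : ℝ := limUnder atBot ν

theorem IsWeight.tendsto_negInf {ν : ℝ → ℝ} (hν : IsWeight ν) :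
    Tendsto ν atBot (𝓝 (negInf ν)) :=
  tendsto_nhds_limUnder
    ⟨_, tendsto_atBot_ciInf hν.mono ⟨0, by rintro _ ⟨t, rfl⟩; exact hν.nonneg t⟩⟩

/-- The integrand `1/(t-z) - t/(1+t²)` times `ν(t)`. -/
noncomputable def cauchyIntegrand (ν : ℝ → ℝ) (z : ℂ) (t : ℝ) : ℂ :=
  (1 / ((t : ℂ) - z) - (t : ℂ) / (1 + (t : ℂ) ^ 2)) * (ν t : ℂ)

/-- The integrand `log (√(1+t²) / (t-z))`, with the principal branch of the logarithm. -/
noncomputable def logIntegrand (z : ℂ) (t : ℝ) : ℂ :=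
  Complex.log ((Real.sqrt (1 + t ^ 2) : ℂ) / ((t : ℂ) - z))

/-- `α z + β + ∫ (1/(t-z) - t/(1+t²)) ν(t) dt`. -/
noncomputable def cauchyRep (α β : ℝ) (ν : ℝ → ℝ) (z : ℂ) : ℂ :=
  α * z + β + ∫ t : ℝ, cauchyIntegrand ν z t

/-- `α z + β + i π ν(-∞) + ∫ log (√(1+t²) / (t-z)) dν(t)`. -/
noncomputable def logRep (α β : ℝ) (ν : ℝ → ℝ) (hν : Monotone ν) (z : ℂ) : ℂ :=
  α * z + β + Complex.I * Real.pi * negInf ν + ∫ t : ℝ, logIntegrand z t ∂(lsMeasure ν hν)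

/-- The cone in the upper half-plane with vertex `x` and aperture parameter `k`. -/
def stolzCone (x k : ℝ) : Set ℂ := {z : ℂ | 0 < z.im ∧ |z.re - x| < k * z.im}

/-- `u(z)` tends to the finite limit `l` as `z ∈ ℍ` tends to `x` non-tangentially, that is, within
each cone with vertex `x`. -/
def HasNontangentialLimit (u : ℂ → ℝ) (x l : ℝ) : Prop :=
  ∀ k : ℝ, 0 < k → Tendsto u (𝓝[stolzCone x k] (x : ℂ)) (𝓝 l)

/-- The set of points `x` at which `u` has a finite non-tangential limit. -/
def limitSet (u : ℂ → ℝ) : Set ℝ := {x | ∃ l : ℝ, HasNontangentialLimit u x l}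

/-- The set of discontinuities of a non-decreasing function: `ν(x-0) < ν(x+0)`. -/
def jumpSet (ν : ℝ → ℝ) : Set ℝ := {x | Function.leftLim ν x < Function.rightLim ν x}

/-- `ν(x) = (ν(x+0) + ν(x-0)) / 2` at every `x`. -/
def IsMidpointNormalized (ν : ℝ → ℝ) : Prop :=
  ∀ x, ν x = (Function.rightLim ν x + Function.leftLim ν x) / 2

end Pick

open Pick

/-! Since `∂ₓ Im Φ = Im Φ'`, the condition on `Φ'` says that `Im Φ` is non-decreasing along
horizontal lines of the upper half-plane. This is the property a Poisson integral inherits from a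
non-decreasing density.

From `Φ` to the representation: Herglotz's theorem (`exists_measure_im_eq_poisson`, carried over
from the disc by the Cayley transform) writes `Im Φ'` as `a y` plus the Poisson integral of a
measure `μ`. Being non-negative and non-decreasing in `x`, `Im Φ(x+iy)` has a finite limit `g(y) ≥
0` at `x = -∞`, and `Im Φ - g` is the integral of `Im Φ'` over `(-∞, x]`. Finiteness of that
integral forces `a = 0`, and Tonelli turns it into the Poisson integral of `ν(t) = μ((-∞, t])`. What
remains of `Φ` has imaginary part `g(y)`, hence is `α z + c` with `α` real. Non-negativity of `g`
gives `α ≥ 0` and `Im c ≥ 0`. As the kernel `1/(t-z) - t/(1+t²)` has integral `iπ`, adding the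
constant `Im c / π` to `ν` absorbs `i Im c`. Conversely, a Poisson integral is a convolution with a
positive kernel, so it is monotone in `x` when `ν` is.

The logarithmic form is integration by parts: `ν(t) - ν(-∞)` is almost everywhere the `dν`-mass of
`(-∞, t]`, and Fubini replaces the kernel by its tail integral, a logarithm.

Boundary values follow by dominated convergence in the logarithmic form. For `Im Φ`, the limit along
a ray depends on its direction exactly when `ν` jumps; vertical rays give Stieltjes inversion, hence
uniqueness. For `Re Φ`, the logarithmic potential of `dν` converges almost everywhere because `log`
is locally integrable, and `coneMajorant` dominates the difference inside a cone. -/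

/-! ### Herglotz's theorem in the disc and the half-plane -/

theorem continuous_poissonKernel_sphere {w : ℂ} (hw : w ∈ Metric.ball (0 : ℂ) 1) :
    Continuous (fun ζ : Metric.sphere (0 : ℂ) 1 => poissonKernel 0 w ζ) := by
  have hne : ∀ ζ : Metric.sphere (0 : ℂ) 1, ‖((ζ : ℂ) - 0) - (w - 0)‖ ^ 2 ≠ 0 := by
    intro ζ h
    have h1 : (ζ : ℂ) = w := by simpa [sub_eq_zero] using h
    have h2 : ‖(ζ : ℂ)‖ = 1 := by simp
    rw [h1] at h2
    simp [h2] at hw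
  unfold poissonKernel
  exact Continuous.div (by fun_prop) (by fun_prop) hne

/-- The Poisson integral formula on a circle of radius `r < 1`, as an integral over the unit circle
against a finite measure. -/
theorem exists_finiteMeasure_poisson_dilate {F : ℂ → ℂ}
    (hF : DifferentiableOn ℂ F (Metric.ball 0 1))
    (hre : ∀ w ∈ Metric.ball (0 : ℂ) 1, 0 ≤ (F w).re) {r : ℝ} (hr0 : 0 < r) (hr1 : r < 1) :
    ∃ μ : FiniteMeasure (Metric.sphere (0 : ℂ) 1), ∀ w ∈ Metric.ball (0 : ℂ) 1,
      (F (r * w)).re = ∫ ζ, poissonKernel 0 w ζ ∂(μ : Measure (Metric.sphere (0 : ℂ) 1)) := by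
  have hmaps : MapsTo (fun z : ℂ => (r : ℂ) * z) (Metric.closedBall 0 1) (Metric.ball 0 1) := by
    intro z hz
    simp only [Metric.mem_closedBall, dist_zero_right, Metric.mem_ball, norm_mul,
      Complex.norm_real, Real.norm_eq_abs, abs_of_pos hr0] at hz ⊢
    nlinarith [norm_nonneg z]
  have hdiff : DifferentiableOn ℂ (fun z => F (r * z)) (Metric.closedBall 0 1) :=
    hF.comp (by fun_prop) hmaps
  have hdc : DiffContOnCl ℂ (fun z => F (r * z)) (Metric.ball 0 1) := by
    apply DifferentiableOn.diffContOnCl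
    rwa [closure_ball 0 one_ne_zero]
  have hc : ∀ θ : ℝ, circleMap 0 1 θ ∈ Metric.closedBall (0 : ℂ) 1 := fun θ =>
    Metric.sphere_subset_closedBall (circleMap_mem_sphere 0 zero_le_one θ)
  have hcont : Continuous (fun θ : ℝ => (F (r * circleMap 0 1 θ)).re) :=
    Complex.continuous_re.comp
      (hdiff.continuousOn.comp_continuous (continuous_circleMap 0 1) hc)
  have hnn : ∀ θ : ℝ, 0 ≤ (F (r * circleMap 0 1 θ)).re := fun θ => hre _ (hmaps (hc θ))
  let T : ℝ → Metric.sphere (0 : ℂ) 1 :=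
    fun θ => ⟨circleMap 0 1 θ, circleMap_mem_sphere 0 zero_le_one θ⟩
  have hT : Continuous T := (continuous_circleMap 0 1).subtype_mk _
  let d : ℝ → ℝ := fun θ => (2 * Real.pi)⁻¹ * (F (r * circleMap 0 1 θ)).re
  have hd : Continuous d := continuous_const.mul hcont
  have hd0 : ∀ θ, 0 ≤ d θ := fun θ => mul_nonneg (by positivity) (hnn θ)
  -- The boundary values of `Re F(r ·)`, divided by `2π`, serve as a density in the angle.
  let ρ : Measure ℝ := (volume.restrict (Ioc 0 (2 * Real.pi))).withDensity
    (fun θ => ENNReal.ofReal (d θ))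
  have hdint : Integrable d (volume.restrict (Ioc 0 (2 * Real.pi))) :=
    (hd.integrableOn_Icc).mono_set Ioc_subset_Icc_self
  have : IsFiniteMeasure ρ := isFiniteMeasure_withDensity_ofReal hdint.2
  refine ⟨⟨ρ.map T, inferInstance⟩, fun w hw => ?_⟩
  have hK := continuous_poissonKernel_sphere hw
  have hP := hdc.circleAverage_poissonKernel_smul hw
  have hint : IntervalIntegrable
      (fun θ => poissonKernel 0 w (circleMap 0 1 θ) • F (r * circleMap 0 1 θ))
      volume 0 (2 * Real.pi) :=
    Continuous.intervalIntegrable ((hK.comp hT).smul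
      (hdiff.continuousOn.comp_continuous (continuous_circleMap 0 1) hc)) _ _
  have hP2 := congrArg Complex.re hP
  rw [Real.circleAverage_def, Complex.smul_re] at hP2
  have hre2 := Complex.reCLM.intervalIntegral_comp_comm hint
  simp only [Complex.reCLM_apply] at hre2
  simp only [Pi.smul_apply'] at hP2
  rw [← hre2] at hP2
  rw [← hP2, FiniteMeasure.toMeasure_mk, integral_map hT.measurable.aemeasurable
    hK.aestronglyMeasurable,
    integral_withDensity_eq_integral_toReal_smul (by fun_prop) (by simp),
    intervalIntegral.integral_of_le (by positivity), smul_eq_mul,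
    ← integral_const_mul]
  refine integral_congr_ae (Eventually.of_forall fun θ => ?_)
  simp only [T, d, ENNReal.toReal_ofReal (hd0 θ), smul_eq_mul]
  simp
  ring

/-- **Herglotz's theorem**: a holomorphic function on the unit disc with non-negative real part has
the Poisson integral of a finite measure on the circle as its real part. -/
theorem exists_finiteMeasure_re_eq_integral_poissonKernel {F : ℂ → ℂ}
    (hF : DifferentiableOn ℂ F (Metric.ball 0 1))
    (hre : ∀ w ∈ Metric.ball (0 : ℂ) 1, 0 ≤ (F w).re) :
    ∃ μ : FiniteMeasure (Metric.sphere (0 : ℂ) 1), ∀ w ∈ Metric.ball (0 : ℂ) 1,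
      (F w).re = ∫ ζ, poissonKernel 0 w ζ ∂(μ : Measure (Metric.sphere (0 : ℂ) 1)) := by
  -- The radii `1 - 1/(n+2)` start at `1/2`; with `n+1` the first one would be `0`.
  have hr : ∀ n : ℕ, (0 : ℝ) < 1 - 1 / (n + 2) ∧ (1 : ℝ) - 1 / (n + 2) < 1 := by
    intro n
    have h : (0 : ℝ) < n + 2 := by positivity
    constructor
    · rw [sub_pos, div_lt_one h]; linarith [(Nat.cast_nonneg n : (0 : ℝ) ≤ n)]
    · simp; positivity
  choose μ hμ using fun n : ℕ =>
    exists_finiteMeasure_poisson_dilate hF hre (hr n).1 (hr n).2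
  -- The Poisson kernel at the centre is `1`, so every `μ n` has total mass `Re F(0)`. This uniform
  -- bound gives weak compactness.
  have hmass : ∀ n, (μ n).mass ≤ (F 0).re.toNNReal := by
    intro n
    have h := hμ n 0 (by simp)
    have h1 : ∀ ζ : Metric.sphere (0 : ℂ) 1, poissonKernel 0 0 (ζ : ℂ) = 1 := by
      intro ζ
      simp [poissonKernel_def]
    simp only [mul_zero, h1, integral_const, smul_eq_mul, mul_one] at h
    rw [h]
    refine le_of_eq (NNReal.eq ?_)
    rw [Real.coe_toNNReal _ measureReal_nonneg]
    rfl
  obtain ⟨m, -, hm⟩ := (isCompact_setOfPred_finiteMeasure_le_of_compactSpace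
    (Metric.sphere (0 : ℂ) 1) (F 0).re.toNNReal).exists_mapClusterPt_of_frequently
    (l := atTop) (f := μ) (Frequently.of_forall hmass)
  obtain ⟨U, hU, hUm⟩ := mapClusterPt_iff_ultrafilter.1 hm
  refine ⟨m, fun w hw => ?_⟩
  have hK := continuous_poissonKernel_sphere hw
  have h1 := (FiniteMeasure.tendsto_iff_forall_integral_tendsto.1 hUm)
    (BoundedContinuousFunction.mkOfCompact ⟨_, hK⟩)
  simp only [BoundedContinuousFunction.mkOfCompact_apply, ContinuousMap.coe_mk] at h1
  have h2 : Tendsto (fun n : ℕ => (F (((1 : ℝ) - 1 / (n + 2) : ℝ) * w)).re) U (𝓝 (F w).re) := by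
    refine Tendsto.mono_left ?_ hU
    have hc : ContinuousAt F w :=
      (hF.differentiableAt (Metric.isOpen_ball.mem_nhds hw)).continuousAt
    have hlim : Tendsto (fun n : ℕ => (((1 : ℝ) - 1 / (n + 2) : ℝ) : ℂ) * w) atTop (𝓝 w) := by
      have : Tendsto (fun n : ℕ => (1 : ℝ) - 1 / (n + 2)) atTop (𝓝 (1 - 0)) :=
        tendsto_const_nhds.sub
          (tendsto_const_nhds.div_atTop (tendsto_atTop_add_const_right _ _
            tendsto_natCast_atTop_atTop))
      have h3 := ((Complex.continuous_ofReal.tendsto _).comp this).mul_const w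
      simpa using h3
    exact (Complex.continuous_re.tendsto _).comp (hc.tendsto.comp hlim)
  refine tendsto_nhds_unique h2 (h1.congr fun n => ?_)
  exact (hμ n w hw).symm

/-- The Poisson kernel of the disc in the coordinates of the half-plane. -/
theorem poissonKernel_cayley (x y a b : ℝ) (hy : 0 < y) (hab : a ^ 2 + b ^ 2 = 1) (ha : a < 1) :
    poissonKernel 0 (((⟨x, y⟩ : ℂ) - Complex.I) / ((⟨x, y⟩ : ℂ) + Complex.I)) ⟨a, b⟩ =
      (1 + (-b / (1 - a)) ^ 2) * (y / (y ^ 2 + (x - -b / (1 - a)) ^ 2)) := by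
  have h1 : (1 - a) ≠ 0 := by linarith
  have hz : (⟨x, y⟩ : ℂ) + Complex.I ≠ 0 := by
    intro h
    have := congrArg Complex.im h
    simp at this
    linarith
  have e1 : ‖(⟨a, b⟩ : ℂ)‖ ^ 2 = 1 := by
    rw [← Complex.normSq_eq_norm_sq, Complex.normSq_apply]; simp only; nlinarith
  have hpos : 0 < x ^ 2 + (y + 1) ^ 2 := by positivity
  have n1 : ‖(⟨x, y⟩ : ℂ) + Complex.I‖ ^ 2 = x ^ 2 + (y + 1) ^ 2 := by
    rw [← Complex.normSq_eq_norm_sq, Complex.normSq_apply]; simp; ring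
  have n2 : ‖(⟨x, y⟩ : ℂ) - Complex.I‖ ^ 2 = x ^ 2 + (y - 1) ^ 2 := by
    rw [← Complex.normSq_eq_norm_sq, Complex.normSq_apply]; simp; ring
  have e3 : (⟨a, b⟩ : ℂ) - ((⟨x, y⟩ : ℂ) - Complex.I) / ((⟨x, y⟩ : ℂ) + Complex.I) =
      (⟨a, b⟩ * (⟨x, y⟩ + Complex.I) - (⟨x, y⟩ - Complex.I)) / (⟨x, y⟩ + Complex.I) := by
    field_simp
  -- Here `-b/(1-a)` is the real point that the Cayley transform assigns to the circle point `a +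
  -- ib`.
  have n3 : ‖(⟨a, b⟩ * (⟨x, y⟩ + Complex.I) - (⟨x, y⟩ - Complex.I) : ℂ)‖ ^ 2 =
      2 * (1 - a) * (y ^ 2 + (x - -b / (1 - a)) ^ 2) := by
    rw [← Complex.normSq_eq_norm_sq, Complex.normSq_apply]
    simp only [Complex.sub_re, Complex.mul_re, Complex.add_re, Complex.I_re, Complex.add_im,
      Complex.I_im, Complex.sub_im, Complex.mul_im]
    field_simp
    linear_combination ((1 - a) * ((x ^ 2 + (y + 1) ^ 2)) - 2) * hab
  have hq : 0 < y ^ 2 + (x - -b / (1 - a)) ^ 2 := by positivity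
  rw [poissonKernel_def, sub_zero, sub_zero, e3, norm_div, norm_div, div_pow, div_pow, n1, n2, n3,
    e1]
  have e4 : 1 + (-b / (1 - a)) ^ 2 = 2 / (1 - a) := by
    field_simp
    linear_combination hab
  rw [e4]
  generalize y ^ 2 + (x - -b / (1 - a)) ^ 2 = q at hq
  field_simp
  ring

/-- **Herglotz's theorem** in the half-plane. -/
theorem exists_measure_im_eq_poisson {G : ℂ → ℂ} (hG : DifferentiableOn ℂ G {z | 0 < z.im})
    (him : ∀ z : ℂ, 0 < z.im → 0 ≤ (G z).im) :
    ∃ (a : ℝ) (μ : Measure ℝ), SFinite μ ∧ 0 ≤ a ∧ ∀ x y : ℝ, 0 < y →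
      ENNReal.ofReal (G ⟨x, y⟩).im =
        ENNReal.ofReal (a * y) + ∫⁻ t, ENNReal.ofReal (y / (y ^ 2 + (x - t) ^ 2)) ∂μ := by
  -- The Cayley transform of the disc onto the half-plane, with inverse `(z - i)/(z + i)`.
  let C : ℂ → ℂ := fun w => Complex.I * (1 + w) / (1 - w)
  have hne : ∀ w ∈ Metric.ball (0 : ℂ) 1, 1 - w ≠ 0 := by
    intro w hw h
    rw [sub_eq_zero] at h
    simp [← h] at hw
  have hC : MapsTo C (Metric.ball 0 1) {z | 0 < z.im} := by
    intro w hw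
    have h1 := hne w hw
    have h2 : ‖w‖ < 1 := by simpa using hw
    have h3 : (C w).im = (1 - Complex.normSq w) / Complex.normSq (1 - w) := by
      simp only [C, Complex.div_im, Complex.normSq_apply]
      simp
      ring
    change 0 < (C w).im
    rw [h3, Complex.normSq_eq_norm_sq w]
    exact div_pos (by nlinarith [norm_nonneg w]) (Complex.normSq_pos.2 h1)
  have hF : DifferentiableOn ℂ (fun w => -Complex.I * G (C w)) (Metric.ball 0 1) := by
    refine (hG.comp (DifferentiableOn.div (by fun_prop) (by fun_prop) hne) hC).const_mul _
  obtain ⟨σ, hσ⟩ := exists_finiteMeasure_re_eq_integral_poissonKernel hF (fun w hw => by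
    simpa using him _ (hC hw))
  -- The circle point sent to infinity: its mass becomes the coefficient of `y`, and the rest of the
  -- circle is carried to the line by `T`.
  let one : Metric.sphere (0 : ℂ) 1 := ⟨1, by simp⟩
  let T : Metric.sphere (0 : ℂ) 1 → ℝ := fun ζ => -(ζ : ℂ).im / (1 - (ζ : ℂ).re)
  have hT : Measurable T := by
    refine Measurable.div ?_ ?_
    · exact (Complex.measurable_im.comp measurable_subtype_coe).neg
    · exact measurable_const.sub (Complex.measurable_re.comp measurable_subtype_coe)
  let s : Measure (Metric.sphere (0 : ℂ) 1) := σ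
  -- The density `1 + t²` is the ratio of the disc kernel to the half-plane kernel in
  -- `poissonKernel_cayley`.
  refine ⟨s.real {one}, ((s.restrict {one}ᶜ).map T).withDensity
    (fun t => ENNReal.ofReal (1 + t ^ 2)), inferInstance, measureReal_nonneg, fun x y hy => ?_⟩
  let w : ℂ := ((⟨x, y⟩ : ℂ) - Complex.I) / ((⟨x, y⟩ : ℂ) + Complex.I)
  have hz : (⟨x, y⟩ : ℂ) + Complex.I ≠ 0 := by
    intro h
    have := congrArg Complex.im h
    simp at this
    linarith
  have hn : ‖(⟨x, y⟩ : ℂ) - Complex.I‖ < ‖(⟨x, y⟩ : ℂ) + Complex.I‖ := by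
    rw [← sq_lt_sq₀ (norm_nonneg _) (norm_nonneg _), ← Complex.normSq_eq_norm_sq,
      ← Complex.normSq_eq_norm_sq, Complex.normSq_apply, Complex.normSq_apply]
    simp
    nlinarith
  have hw : w ∈ Metric.ball (0 : ℂ) 1 := by
    rw [mem_ball_zero_iff, norm_div, div_lt_one (norm_pos_iff.2 hz)]
    exact hn
  have hCw : C w = ⟨x, y⟩ := by
    have h1 := hne w hw
    have h2 : 1 - w = 2 * Complex.I / ((⟨x, y⟩ : ℂ) + Complex.I) := by
      simp only [w]; field_simp; ring
    have h3 : 1 + w = 2 * (⟨x, y⟩ : ℂ) / ((⟨x, y⟩ : ℂ) + Complex.I) := by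
      simp only [w]; field_simp; ring
    simp only [C]
    rw [h2, h3]
    field_simp
  have hK := continuous_poissonKernel_sphere hw
  have hK0 : ∀ ζ : Metric.sphere (0 : ℂ) 1, 0 ≤ poissonKernel 0 w ζ := by
    intro ζ
    have h2 : ‖w‖ < 1 := by simpa using hw
    have h3 : ‖(ζ : ℂ)‖ = 1 := by simp
    rw [poissonKernel_def, sub_zero, sub_zero, h3]
    exact div_nonneg (by nlinarith [norm_nonneg w]) (by positivity)
  have hre := hσ w hw
  have hre' : (-Complex.I * G (C w)).re = (G ⟨x, y⟩).im := by rw [hCw]; simp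
  have hint : Integrable (fun ζ : Metric.sphere (0 : ℂ) 1 => poissonKernel 0 w ζ) s :=
    hK.integrable_of_hasCompactSupport (HasCompactSupport.of_compactSpace _)
  rw [← hre', hre, ofReal_integral_eq_lintegral_ofReal hint (Eventually.of_forall hK0),
    ← lintegral_add_compl _ (measurableSet_singleton one)]
  congr 1
  · rw [lintegral_singleton]
    have h1 : poissonKernel 0 w (one : ℂ) = y := by
      have h2 : ‖(1 : ℂ) - w‖ ^ 2 = 4 / ‖(⟨x, y⟩ : ℂ) + Complex.I‖ ^ 2 := by
        have h2 : 1 - w = 2 * Complex.I / ((⟨x, y⟩ : ℂ) + Complex.I) := by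
          simp only [w]; field_simp; ring
        rw [h2, norm_div, div_pow]
        norm_num
      have h4 : ‖(⟨x, y⟩ : ℂ) + Complex.I‖ ^ 2 ≠ 0 := by
        exact pow_ne_zero _ (norm_ne_zero_iff.2 hz)
      rw [poissonKernel_def]
      simp only [one, sub_zero]
      rw [h2]
      simp only [w]
      rw [norm_div, div_pow]
      field_simp
      simp only [Complex.sq_norm, Complex.normSq_apply]
      simp
      ring
    rw [h1, mul_comm, ENNReal.ofReal_mul measureReal_nonneg, ofReal_measureReal]
  · rw [lintegral_withDensity_eq_lintegral_mul _ (by fun_prop) (by fun_prop),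
      lintegral_map (by fun_prop) hT]
    refine setLIntegral_congr_fun (measurableSet_singleton one).compl fun ζ hζ => ?_
    have h1 : (ζ : ℂ).re ^ 2 + (ζ : ℂ).im ^ 2 = 1 := by
      have h3 : ‖(ζ : ℂ)‖ ^ 2 = 1 := by simp
      rw [← Complex.normSq_eq_norm_sq, Complex.normSq_apply] at h3
      nlinarith
    have h2 : (ζ : ℂ).re < 1 := by
      by_contra h
      have h3 : (ζ : ℂ).re = 1 := by nlinarith [sq_nonneg (ζ : ℂ).im]
      have h4 : (ζ : ℂ).im = 0 := by rw [h3] at h1; nlinarith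
      exact hζ (Subtype.ext (Complex.ext (by simpa [one] using h3) (by simpa [one] using h4)))
    have h3 := poissonKernel_cayley x y _ _ hy h1 h2
    simp only [Complex.eta] at h3
    simp only [Pi.mul_apply, T]
    rw [← ENNReal.ofReal_mul (by positivity), ← h3]

namespace Pick

/-! ### Weights and kernels -/

/-- The kernel `1/(t-z) - t/(1+t²)`. -/
noncomputable def kernel (z : ℂ) (t : ℝ) : ℂ := 1 / ((t : ℂ) - z) - (t : ℂ) / (1 + (t : ℂ) ^ 2)

theorem ofReal_sub_ne_zero {z : ℂ} (hz : z.im ≠ 0) (t : ℝ) : (t : ℂ) - z ≠ 0 := by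
  intro h
  have := congrArg Complex.im h
  simp at this
  exact hz this

theorem one_add_sq_ne_zero (t : ℝ) : (1 : ℂ) + (t : ℂ) ^ 2 ≠ 0 := by
  have : (1 : ℝ) + t ^ 2 ≠ 0 := by positivity
  exact_mod_cast this

theorem continuous_kernel {z : ℂ} (hz : z.im ≠ 0) : Continuous (kernel z) :=
  (continuous_const.div (by fun_prop) (ofReal_sub_ne_zero hz)).sub
    (Continuous.div (by fun_prop) (by fun_prop) one_add_sq_ne_zero)

theorem abs_im_le_norm_ofReal_sub (z : ℂ) (t : ℝ) : |z.im| ≤ ‖(t : ℂ) - z‖ := by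
  simpa using Complex.abs_im_le_norm ((t : ℂ) - z)

/-- The kernel equals `(z + (1+z²)/(t-z)) / (1+t²)`, and `|t-z| ≥ |Im z|`. -/
theorem norm_kernel_le {z : ℂ} (hz : z.im ≠ 0) (t : ℝ) :
    ‖kernel z t‖ ≤ (‖z‖ + ‖1 + z ^ 2‖ / |z.im|) * (1 + t ^ 2)⁻¹ := by
  have h1 := ofReal_sub_ne_zero hz t
  have h2 := one_add_sq_ne_zero t
  have h3 : kernel z t = (z + (1 + z ^ 2) / ((t : ℂ) - z)) * (1 + (t : ℂ) ^ 2)⁻¹ := by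
    unfold kernel
    field_simp
    ring
  have h4 : ‖(1 + (t : ℂ) ^ 2)⁻¹‖ = (1 + t ^ 2)⁻¹ := by
    rw [norm_inv]
    congr 1
    have : (1 : ℂ) + (t : ℂ) ^ 2 = ((1 + t ^ 2 : ℝ) : ℂ) := by push_cast; ring
    rw [this, Complex.norm_real, Real.norm_eq_abs, abs_of_pos (by positivity)]
  rw [h3, norm_mul, h4]
  gcongr
  refine (norm_add_le _ _).trans ?_
  rw [norm_div]
  gcongr
  exact abs_im_le_norm_ofReal_sub z t

theorem integrable_kernel {z : ℂ} (hz : z.im ≠ 0) : Integrable (kernel z) :=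
  (integrable_inv_one_add_sq.const_mul _).mono' (continuous_kernel hz).aestronglyMeasurable
    (Eventually.of_forall (norm_kernel_le hz))

variable {ν : ℝ → ℝ}

/-- The integral condition only controls large positive `t`; to the left of `1`, monotonicity bounds
`ν` by `ν 1`. -/
theorem IsWeight.integrable_inv_one_add_sq_mul (hν : IsWeight ν) :
    Integrable (fun t => (1 + t ^ 2)⁻¹ * ν t) := by
  have hm := hν.mono.measurable
  rw [← integrableOn_univ, ← Iic_union_Ioi (a := (1 : ℝ)), integrableOn_union]
  constructor
  · refine (integrable_inv_one_add_sq.integrableOn.mul_const (ν 1)).mono' (by fun_prop) ?_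
    refine (ae_restrict_iff' measurableSet_Iic).2 (Eventually.of_forall fun t ht => ?_)
    rw [Real.norm_eq_abs, abs_of_nonneg (mul_nonneg (by positivity) (hν.nonneg t))]
    exact mul_le_mul_of_nonneg_left (hν.mono ht) (by positivity)
  · refine hν.integrable.mono' (by fun_prop) ?_
    refine (ae_restrict_iff' measurableSet_Ioi).2 (Eventually.of_forall fun t ht => ?_)
    have ht : (1 : ℝ) < t := ht
    rw [Real.norm_eq_abs, abs_of_nonneg (mul_nonneg (by positivity) (hν.nonneg t)), mul_comm,
      ← div_eq_mul_inv]
    have := hν.nonneg t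
    gcongr
    linarith

theorem IsWeight.integrable_mul_of_bound {E : Type*} [NormedAddCommGroup E] [NormedSpace ℝ E]
    (hν : IsWeight ν) {k : ℝ → E} (hk : AEStronglyMeasurable k) {C : ℝ}
    (hC : ∀ t, ‖k t‖ ≤ C * (1 + t ^ 2)⁻¹) : Integrable (fun t => ν t • k t) := by
  refine (hν.integrable_inv_one_add_sq_mul.const_mul C).mono'
    (hν.mono.measurable.aestronglyMeasurable.smul hk) (Eventually.of_forall fun t => ?_)
  rw [norm_smul, Real.norm_eq_abs, abs_of_nonneg (hν.nonneg t)]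
  calc ν t * ‖k t‖ ≤ ν t * (C * (1 + t ^ 2)⁻¹) :=
        mul_le_mul_of_nonneg_left (hC t) (hν.nonneg t)
    _ = _ := by ring

theorem cauchyIntegrand_eq (ν : ℝ → ℝ) (z : ℂ) : cauchyIntegrand ν z = fun t => ν t • kernel z t := by
  ext t
  simp [cauchyIntegrand, kernel, mul_comm]

theorem IsWeight.integrable_cauchyIntegrand (hν : IsWeight ν) {z : ℂ} (hz : z.im ≠ 0) :
    Integrable (cauchyIntegrand ν z) := by
  rw [cauchyIntegrand_eq]
  exact hν.integrable_mul_of_bound (continuous_kernel hz).aestronglyMeasurable (norm_kernel_le hz)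

/-! ### Integration by parts -/

theorem IsWeight.tendsto_stieltjes (hν : IsWeight ν) :
    Tendsto hν.mono.stieltjesFunction atBot (𝓝 (negInf ν)) := by
  have h1 := hν.tendsto_negInf
  have h2 : Tendsto (fun x : ℝ => ν (x + 1)) atBot (𝓝 (negInf ν)) :=
    h1.comp (tendsto_atBot_add_const_right _ 1 tendsto_id)
  refine tendsto_of_tendsto_of_tendsto_of_le_of_le h1 h2 (fun x => ?_) (fun x => ?_)
  · rw [hν.mono.stieltjesFunction_eq]; exact hν.mono.le_rightLim le_rfl
  · rw [hν.mono.stieltjesFunction_eq]; exact hν.mono.rightLim_le (by linarith)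

theorem IsWeight.negInf_le (hν : IsWeight ν) (t : ℝ) : negInf ν ≤ ν t :=
  le_of_tendsto hν.tendsto_negInf ((eventually_le_atBot t).mono fun _ h => hν.mono h)

theorem IsWeight.negInf_nonneg (hν : IsWeight ν) : 0 ≤ negInf ν :=
  ge_of_tendsto hν.tendsto_negInf (Eventually.of_forall hν.nonneg)

theorem IsWeight.lsMeasure_Iic (hν : IsWeight ν) (t : ℝ) :
    lsMeasure ν hν.mono (Iic t) = ENNReal.ofReal (Function.rightLim ν t - negInf ν) := by
  rw [lsMeasure, StieltjesFunction.measure_Iic _ hν.tendsto_stieltjes,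
    hν.mono.stieltjesFunction_eq]

instance (hν : Monotone ν) : IsLocallyFiniteMeasure (lsMeasure ν hν) :=
  inferInstanceAs (IsLocallyFiniteMeasure hν.stieltjesFunction.measure)

theorem ae_rightLim_eq (hν : Monotone ν) : ∀ᵐ t, Function.rightLim ν t = ν t := by
  have h := hν.countable_not_continuousAt.ae_notMem (volume : Measure ℝ)
  filter_upwards [h] with t ht
  have : ContinuousAt ν t := by simpa using ht
  exact (hν.continuousWithinAt_Ioi_iff_rightLim_eq).1 this.continuousWithinAt

theorem IsWeight.ae_measureReal_Iic (hν : IsWeight ν) :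
    ∀ᵐ t, (lsMeasure ν hν.mono).real (Iic t) = ν t - negInf ν := by
  filter_upwards [ae_rightLim_eq hν.mono] with t ht
  rw [Measure.real, hν.lsMeasure_Iic, ht, ENNReal.toReal_ofReal (by linarith [hν.negInf_le t])]

section Layer

variable {E : Type*} [NormedAddCommGroup E] [NormedSpace ℝ E]

/-- Justifies Fubini for `1_{s ≤ t} k(t)`: integrating the norm in `s` first gives `(ν(t) - ν(-∞))
‖k(t)‖` for almost every `t`, at most `ν(t) ‖k(t)‖`. -/
theorem IsWeight.integrable_layer (hν : IsWeight ν) {k : ℝ → E} (hk : AEStronglyMeasurable k)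
    (hkν : Integrable (fun t => ν t • k t)) :
    Integrable (fun p : ℝ × ℝ => (Ici p.1).indicator k p.2)
      ((lsMeasure ν hν.mono).prod volume) := by
  have he : (fun p : ℝ × ℝ => (Ici p.1).indicator k p.2) =
      {p : ℝ × ℝ | p.1 ≤ p.2}.indicator (fun p => k p.2) := by
    ext p
    by_cases h : p.1 ≤ p.2 <;> simp [h]
  have hmeas : AEStronglyMeasurable (fun p : ℝ × ℝ => (Ici p.1).indicator k p.2)
      ((lsMeasure ν hν.mono).prod volume) := by
    rw [he]
    exact (hk.comp_snd).indicator (measurableSet_le measurable_fst measurable_snd)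
  have hsec : ∀ t : ℝ, (fun s : ℝ => (Ici s).indicator k t) = (Iic t).indicator fun _ => k t := by
    intro t
    ext s
    by_cases h : s ≤ t <;> simp [h]
  rw [integrable_prod_iff' hmeas]
  constructor
  · refine Eventually.of_forall fun t => ?_
    simp only [hsec]
    refine (integrable_indicator_iff measurableSet_Iic).2 (integrableOn_const ?_)
    rw [hν.lsMeasure_Iic]
    exact ENNReal.ofReal_ne_top
  · have hb : Integrable (fun t => (ν t - negInf ν) * ‖k t‖) := by
      refine hkν.mono ((hν.mono.measurable.sub_const _).aestronglyMeasurable.mul hk.norm)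
        (Eventually.of_forall fun t => ?_)
      have h1 := hν.negInf_le t
      have h2 := hν.negInf_nonneg
      rw [norm_mul, norm_norm, norm_smul, Real.norm_eq_abs, Real.norm_eq_abs,
        abs_of_nonneg (by linarith), abs_of_nonneg (hν.nonneg t)]
      gcongr
      linarith
    refine hb.congr ?_
    filter_upwards [hν.ae_measureReal_Iic] with t ht
    have h1 : ∀ s : ℝ, ‖(Ici s).indicator k t‖ = (Iic t).indicator (fun _ => ‖k t‖) s := by
      intro s
      by_cases h : s ≤ t <;> simp [h]
    simp only [h1]
    rw [integral_indicator measurableSet_Iic, setIntegral_const, ht, smul_eq_mul]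

theorem IsWeight.integrable_integral_Ici (hν : IsWeight ν) {k : ℝ → E} (hk : AEStronglyMeasurable k)
    (hkν : Integrable (fun t => ν t • k t)) :
    Integrable (fun s => ∫ t in Ici s, k t) (lsMeasure ν hν.mono) := by
  refine (hν.integrable_layer hk hkν).integral_prod_left.congr (Eventually.of_forall fun s => ?_)
  exact integral_indicator measurableSet_Ici

/-- Integration by parts: `∫ ν k = ν(-∞) ∫ k + ∫ (∫_s^∞ k) dν(s)`. -/
theorem IsWeight.integral_smul_eq (hν : IsWeight ν) {k : ℝ → E} [CompleteSpace E]
    (hk : Integrable k) (hkν : Integrable (fun t => ν t • k t)) :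
    ∫ t, ν t • k t = negInf ν • (∫ t, k t) + ∫ s, (∫ t in Ici s, k t) ∂(lsMeasure ν hν.mono) := by
  have h := integral_integral_swap (f := fun s t => (Ici s).indicator k t) (hν.integrable_layer hk.aestronglyMeasurable hkν)
  have h1 : ∫ s, (∫ t in Ici s, k t) ∂(lsMeasure ν hν.mono) = ∫ t, (ν t - negInf ν) • k t := by
    simp only [integral_indicator measurableSet_Ici] at h
    rw [h]
    refine integral_congr_ae ?_
    filter_upwards [hν.ae_measureReal_Iic] with t ht
    have h1 : ∀ s : ℝ, (Ici s).indicator k t = (Iic t).indicator (fun _ => k t) s := by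
      intro s
      by_cases h : s ≤ t <;> simp [h]
    simp only [h1]
    rw [integral_indicator measurableSet_Iic, setIntegral_const, ht]
  have h2 : Integrable (fun t => negInf ν • k t) := hk.smul _
  have h3 : Integrable (fun t => (ν t - negInf ν) • k t) := by
    simpa only [sub_smul] using! hkν.sub h2
  rw [h1, ← integral_smul, ← integral_add h2 h3]
  simp [sub_smul]

end Layer

/-! ### The logarithmic primitive of the kernel -/

/-- The primitive `log (t-z) - log √(1+t²)` of the kernel. -/
noncomputable def kernelPrim (z : ℂ) (t : ℝ) : ℂ :=
  Complex.log ((t : ℂ) - z) - ((Real.log (1 + t ^ 2) / 2 : ℝ) : ℂ)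

theorem ofReal_sub_mem_slitPlane {z : ℂ} (hz : z.im ≠ 0) (t : ℝ) :
    (t : ℂ) - z ∈ Complex.slitPlane := by
  refine Or.inr ?_
  simpa using hz

theorem hasDerivAt_kernelPrim {z : ℂ} (hz : z.im ≠ 0) (t : ℝ) :
    HasDerivAt (kernelPrim z) (kernel z t) t := by
  have h1 : HasDerivAt (fun t : ℝ => Complex.log ((t : ℂ) - z)) (1 / ((t : ℂ) - z)) t :=
    ((Complex.ofRealCLM.hasDerivAt (x := t)).sub_const z).clog_real
      (ofReal_sub_mem_slitPlane hz t)
  have h2 : HasDerivAt (fun t : ℝ => Real.log (1 + t ^ 2) / 2) (t / (1 + t ^ 2)) t := by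
    have h3 : HasDerivAt (fun t : ℝ => 1 + t ^ 2) (2 * t) t := by
      simpa using (hasDerivAt_pow 2 t).const_add 1
    have h4 := (h3.log (by positivity)).div_const 2
    convert! h4 using 1
    ring
  have h3 := h1.sub h2.ofReal_comp
  have h4 : kernelPrim z = (fun t : ℝ => Complex.log ((t : ℂ) - z)) -
      fun y : ℝ => ((Real.log (1 + y ^ 2) / 2 : ℝ) : ℂ) := rfl
  rw [h4]
  simpa [kernel] using h3

theorem half_log_eq_log_sqrt (t : ℝ) : Real.log (1 + t ^ 2) / 2 = Real.log √(1 + t ^ 2) :=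
  (Real.log_sqrt (by positivity)).symm

theorem kernelPrim_eq_log (z : ℂ) {t : ℝ} (h : (t : ℂ) - z ≠ 0) :
    kernelPrim z t = Complex.log (((√(1 + t ^ 2))⁻¹ : ℝ) * ((t : ℂ) - z)) := by
  have h1 : 0 < √(1 + t ^ 2) := Real.sqrt_pos.2 (by positivity)
  rw [Complex.log_ofReal_mul (by positivity) h, kernelPrim, half_log_eq_log_sqrt, Real.log_inv]
  push_cast
  ring

theorem logIntegrand_eq_neg_kernelPrim {z : ℂ} (hz : z.im ≠ 0) (t : ℝ) :
    logIntegrand z t = -kernelPrim z t := by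
  have h := ofReal_sub_ne_zero hz t
  have h1 : 0 < √(1 + t ^ 2) := Real.sqrt_pos.2 (by positivity)
  rw [kernelPrim_eq_log z h, logIntegrand, ← Complex.log_inv]
  · congr 1
    push_cast
    rw [mul_inv, inv_inv]
    rfl
  -- The rule `log w⁻¹ = -log w` fails only for argument `π`, which a nonzero imaginary part
  -- excludes.
  · intro h2
    have h3 := (Complex.arg_eq_pi_iff.1 h2).2
    rw [Complex.im_ofReal_mul] at h3
    simp [h1.ne', hz] at h3

theorem tendsto_ratio_atTop : Tendsto (fun t : ℝ => (√(1 + t ^ 2))⁻¹ * t) atTop (𝓝 1) := by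
  have h1 : Tendsto (fun t : ℝ => √(1 - (1 + t ^ 2)⁻¹)) atTop (𝓝 √(1 - 0)) := by
    refine (Real.continuous_sqrt.tendsto _).comp (tendsto_const_nhds.sub ?_)
    exact tendsto_inv_atTop_zero.comp
      (tendsto_atTop_add_const_left _ _ (tendsto_pow_atTop two_ne_zero))
  rw [sub_zero, Real.sqrt_one] at h1
  refine h1.congr' ((eventually_ge_atTop 0).mono fun t ht => ?_)
  have h2 : 1 - (1 + t ^ 2)⁻¹ = (1 + t ^ 2)⁻¹ * t ^ 2 := by field_simp; ring
  rw [h2, Real.sqrt_mul (by positivity), Real.sqrt_inv, Real.sqrt_sq ht]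

theorem tendsto_inv_sqrt_atTop : Tendsto (fun t : ℝ => (√(1 + t ^ 2))⁻¹) atTop (𝓝 0) :=
  tendsto_inv_atTop_zero.comp (Real.tendsto_sqrt_atTop.comp
    (tendsto_atTop_add_const_left _ _ (tendsto_pow_atTop two_ne_zero)))

theorem tendsto_kernelPrim_atTop {z : ℂ} (hz : z.im ≠ 0) :
    Tendsto (kernelPrim z) atTop (𝓝 0) := by
  have h1 : Tendsto (fun t : ℝ => (((√(1 + t ^ 2))⁻¹ : ℝ) : ℂ) * ((t : ℂ) - z)) atTop (𝓝 1) := by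
    have h2 := (Complex.continuous_ofReal.tendsto _).comp tendsto_ratio_atTop
    have h3 := ((Complex.continuous_ofReal.tendsto _).comp tendsto_inv_sqrt_atTop).mul_const z
    have h4 := h2.sub h3
    simp only [Complex.ofReal_one, Complex.ofReal_zero, zero_mul, sub_zero] at h4
    refine h4.congr fun t => ?_
    simp
    ring
  have h5 := (Complex.differentiableAt_log Complex.one_mem_slitPlane).continuousAt.tendsto.comp h1
  rw [Complex.log_one] at h5
  exact h5.congr fun t => (kernelPrim_eq_log z (ofReal_sub_ne_zero hz t)).symm

/-- The normalized argument tends to `-1`, on the branch cut, from the lower side because `Im (t-z)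
< 0`. The resulting `-iπ` is the source of the term `iπ ν(-∞)`. -/
theorem tendsto_kernelPrim_atBot {z : ℂ} (hz : 0 < z.im) :
    Tendsto (kernelPrim z) atBot (𝓝 (-(Real.pi * Complex.I))) := by
  have h1 : Tendsto (fun t : ℝ => (((√(1 + t ^ 2))⁻¹ : ℝ) : ℂ) * ((t : ℂ) - z)) atBot (𝓝 (-1)) := by
    have h2 := (Complex.continuous_ofReal.tendsto _).comp
      (tendsto_ratio_atTop.comp tendsto_neg_atBot_atTop).neg
    have h3 := ((Complex.continuous_ofReal.tendsto _).comp
      (tendsto_inv_sqrt_atTop.comp tendsto_neg_atBot_atTop)).mul_const z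
    have h4 := h2.sub h3
    simp only [Complex.ofReal_one, Complex.ofReal_zero, zero_mul, sub_zero, Complex.ofReal_neg]
      at h4
    refine h4.congr fun t => ?_
    simp
    ring
  have h2 : Tendsto (fun t : ℝ => (((√(1 + t ^ 2))⁻¹ : ℝ) : ℂ) * ((t : ℂ) - z)) atBot
      (𝓝[{z : ℂ | z.im < 0}] (-1)) := by
    refine tendsto_nhdsWithin_iff.2 ⟨h1, Eventually.of_forall fun t => ?_⟩
    have h3 : 0 < √(1 + t ^ 2) := Real.sqrt_pos.2 (by positivity)
    change (_ : ℂ).im < 0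
    rw [Complex.im_ofReal_mul]
    refine mul_neg_of_pos_of_neg (by positivity) ?_
    simpa using hz
  have h5 := (Complex.tendsto_log_nhdsWithin_im_neg_of_re_neg_of_im_zero
    (z := -1) (by simp) (by simp)).comp h2
  refine (h5.congr fun t => (kernelPrim_eq_log z (ofReal_sub_ne_zero hz.ne' t)).symm).trans ?_
  simp

theorem integral_kernel {z : ℂ} (hz : 0 < z.im) : ∫ t, kernel z t = Real.pi * Complex.I := by
  rw [integral_of_hasDerivAt_of_tendsto (hasDerivAt_kernelPrim hz.ne') (integrable_kernel hz.ne')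
    (tendsto_kernelPrim_atBot hz) (tendsto_kernelPrim_atTop hz.ne')]
  ring

theorem integral_kernel_Ici {z : ℂ} (hz : z.im ≠ 0) (s : ℝ) :
    ∫ t in Ici s, kernel z t = logIntegrand z s := by
  rw [integral_Ici_eq_integral_Ioi, integral_Ioi_of_hasDerivAt_of_tendsto'
    (fun t _ => hasDerivAt_kernelPrim hz t) (integrable_kernel hz).integrableOn
    (tendsto_kernelPrim_atTop hz), logIntegrand_eq_neg_kernelPrim hz, zero_sub]

theorem IsWeight.integrable_logIntegrand (hν : IsWeight ν) {z : ℂ} (hz : z.im ≠ 0) :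
    Integrable (logIntegrand z) (lsMeasure ν hν.mono) := by
  have h := hν.integrable_integral_Ici (integrable_kernel hz).aestronglyMeasurable
    (by simpa only [cauchyIntegrand_eq] using hν.integrable_cauchyIntegrand hz)
  simpa only [integral_kernel_Ici hz] using h

theorem IsWeight.integral_cauchyIntegrand (hν : IsWeight ν) {z : ℂ} (hz : 0 < z.im) :
    ∫ t, cauchyIntegrand ν z t =
      Complex.I * Real.pi * negInf ν + ∫ t, logIntegrand z t ∂(lsMeasure ν hν.mono) := by
  have h := hν.integral_smul_eq (integrable_kernel hz.ne')
    (by simpa only [cauchyIntegrand_eq] using hν.integrable_cauchyIntegrand hz.ne')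
  rw [cauchyIntegrand_eq]
  refine h.trans (congrArg₂ _ ?_ (integral_congr_ae
    (Eventually.of_forall (integral_kernel_Ici hz.ne'))))
  rw [integral_kernel hz, Complex.real_smul]
  ring

theorem IsWeight.cauchyRep_eq_logRep (hν : IsWeight ν) (α β : ℝ) {z : ℂ} (hz : 0 < z.im) :
    cauchyRep α β ν z = logRep α β ν hν.mono z := by
  rw [cauchyRep, logRep, hν.integral_cauchyIntegrand hz]
  ring

/-- On this half-line `1/(s-x)` is the tail integral of `1/(t-x)²`, so integration by parts applies.
The case `x = 0` is the claim about `∫ t⁻¹ dν`; general `x` serves `coneMajorant`. -/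
theorem IsWeight.integrableOn_inv_sub (hν : IsWeight ν) (x : ℝ) :
    IntegrableOn (fun t : ℝ => 1 / (t - x)) (Ici (x + 1)) (lsMeasure ν hν.mono) := by
  let k : ℝ → ℝ := (Ici (x + 1)).indicator fun t => 1 / (t - x) ^ 2
  have hk : Measurable k := Measurable.indicator (by fun_prop) measurableSet_Ici
  -- The constant comes from `t² ≤ 2(t-x)² + 2x²` together with `(t-x)² ≥ 1`.
  have hb : ∀ t, ‖k t‖ ≤ (3 + 2 * x ^ 2) * (1 + t ^ 2)⁻¹ := by
    intro t
    by_cases h : t ∈ Ici (x + 1)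
    · have h1 : 1 ≤ t - x := by linarith [mem_Ici.1 h]
      simp only [k, indicator_of_mem h]
      rw [Real.norm_eq_abs, abs_of_nonneg (by positivity), ← div_eq_mul_inv,
        div_le_div_iff₀ (by positivity) (by positivity)]
      nlinarith [sq_nonneg (t - 2 * x), mul_nonneg (sq_nonneg x) (by nlinarith : 0 ≤ (t - x) ^ 2 - 1)]
    · simp only [k, indicator_of_notMem h, norm_zero]
      positivity
  have h := hν.integrable_integral_Ici hk.aestronglyMeasurable
    (hν.integrable_mul_of_bound hk.aestronglyMeasurable hb)
  refine h.integrableOn.congr_fun (fun s hs => ?_) measurableSet_Ici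
  have hs1 : x + 1 ≤ s := hs
  have h0 : ∫ t in Ici s, k t = ∫ t in Ioi s, 1 / (t - x) ^ 2 := by
    rw [integral_Ici_eq_integral_Ioi]
    refine setIntegral_congr_fun measurableSet_Ioi fun t ht => ?_
    have ht : s < t := ht
    exact indicator_of_mem (mem_Ici.2 (by linarith)) _
  change ∫ t in Ici s, k t = 1 / (s - x)
  rw [h0]
  have hd : ∀ t ∈ Ici s, HasDerivAt (fun t : ℝ => -(1 / (t - x))) (1 / (t - x) ^ 2) t := by
    intro t ht
    have ht : s ≤ t := ht
    have h1 : t - x ≠ 0 := by linarith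
    have h2 := (((hasDerivAt_id t).sub_const x).inv h1).neg
    refine (h2.congr_deriv (by simp [neg_div])).congr_of_eventuallyEq
      (Eventually.of_forall fun t => ?_)
    simp
  have hl : Tendsto (fun t : ℝ => -(1 / (t - x))) atTop (𝓝 0) := by
    have := (tendsto_inv_atTop_zero.comp (tendsto_atTop_add_const_right atTop (-x) tendsto_id)).neg
    simpa [sub_eq_add_neg, Function.comp_def] using this
  rw [integral_Ioi_of_hasDerivAt_of_nonneg' hd (fun t _ => by positivity) hl]
  ring

/-! ### Real and imaginary parts -/

theorem kernel_re (x y t : ℝ) :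
    (kernel ⟨x, y⟩ t).re = (t - x) / (y ^ 2 + (x - t) ^ 2) - t / (1 + t ^ 2) := by
  have h1 : (t : ℂ) / (1 + (t : ℂ) ^ 2) = ((t / (1 + t ^ 2) : ℝ) : ℂ) := by push_cast; ring
  rw [kernel, Complex.sub_re, h1, Complex.ofReal_re, one_div, Complex.inv_re, Complex.normSq_apply]
  simp
  ring

theorem kernel_im (x y t : ℝ) : (kernel ⟨x, y⟩ t).im = y / (y ^ 2 + (x - t) ^ 2) := by
  have h1 : (t : ℂ) / (1 + (t : ℂ) ^ 2) = ((t / (1 + t ^ 2) : ℝ) : ℂ) := by push_cast; ring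
  rw [kernel, Complex.sub_im, h1, Complex.ofReal_im, one_div, Complex.inv_im, Complex.normSq_apply]
  simp
  ring

theorem cauchyIntegrand_re (ν : ℝ → ℝ) (x y t : ℝ) : (cauchyIntegrand ν ⟨x, y⟩ t).re =
    ((t - x) / (y ^ 2 + (x - t) ^ 2) - t / (1 + t ^ 2)) * ν t := by
  rw [cauchyIntegrand_eq, Complex.smul_re, kernel_re, smul_eq_mul, mul_comm]

theorem cauchyIntegrand_im (ν : ℝ → ℝ) (x y t : ℝ) : (cauchyIntegrand ν ⟨x, y⟩ t).im =
    y / (y ^ 2 + (x - t) ^ 2) * ν t := by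
  rw [cauchyIntegrand_eq, Complex.smul_im, kernel_im, smul_eq_mul, mul_comm]

theorem norm_ofReal_sub_mk (x y t : ℝ) : ‖(t : ℂ) - ⟨x, y⟩‖ = √(y ^ 2 + (t - x) ^ 2) := by
  rw [Complex.norm_def, Complex.normSq_apply]
  simp
  ring_nf

theorem logIntegrand_re_eq (z : ℂ) (t : ℝ) :
    (logIntegrand z t).re = Real.log (√(1 + t ^ 2) / ‖(t : ℂ) - z‖) := by
  rw [logIntegrand, Complex.log_re, norm_div, Complex.norm_real, Real.norm_eq_abs,
    abs_of_nonneg (Real.sqrt_nonneg _)]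

theorem logIntegrand_re (x y t : ℝ) : (logIntegrand ⟨x, y⟩ t).re =
    Real.log √((1 + t ^ 2) / (y ^ 2 + (t - x) ^ 2)) := by
  rw [logIntegrand_re_eq, norm_ofReal_sub_mk, Real.sqrt_div (by positivity)]

theorem logIntegrand_im (x : ℝ) {y : ℝ} (hy : 0 < y) (t : ℝ) : (logIntegrand ⟨x, y⟩ t).im =
    Real.pi / 2 - Real.arctan ((t - x) / y) := by
  set u := (t - x) / y with hu
  have h1 : 0 < √(1 + t ^ 2) := Real.sqrt_pos.2 (by positivity)
  have h2 : 0 < √(1 + u ^ 2) := Real.sqrt_pos.2 (by positivity)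
  have h2' : √(1 + u ^ 2) ^ 2 = 1 + u ^ 2 := Real.sq_sqrt (by positivity)
  have hz : (t : ℂ) - ⟨x, y⟩ ≠ 0 := ofReal_sub_ne_zero (z := ⟨x, y⟩) hy.ne' t
  have hr : 0 < √(1 + t ^ 2) / (y * √(1 + u ^ 2)) := by positivity
  have hcos : Real.cos (Real.pi / 2 - Real.arctan u) = u / √(1 + u ^ 2) := by
    rw [Real.cos_pi_div_two_sub, Real.sin_arctan]
  have hsin : Real.sin (Real.pi / 2 - Real.arctan u) = 1 / √(1 + u ^ 2) := by
    rw [Real.sin_pi_div_two_sub, Real.cos_arctan]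
  have hty : t - x = u * y := by rw [hu]; field_simp
  -- Polar form: with `t - z = y(u - i)`, the number `1/(u - i)` has modulus `1/√(1+u²)` and
  -- argument `π/2 - arctan u`, which lies in `(0, π)`.
  have key : (√(1 + t ^ 2) : ℂ) / ((t : ℂ) - ⟨x, y⟩) =
      ((√(1 + t ^ 2) / (y * √(1 + u ^ 2)) : ℝ) : ℂ) *
        (Complex.cos ((Real.pi / 2 - Real.arctan u : ℝ) : ℂ) +
          Complex.sin ((Real.pi / 2 - Real.arctan u : ℝ) : ℂ) * Complex.I) := by
    rw [← Complex.ofReal_cos, ← Complex.ofReal_sin, hcos, hsin, div_eq_iff hz]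
    apply Complex.ext
    · rw [mul_assoc, Complex.re_ofReal_mul, Complex.mul_re]
      simp [hty]
      field_simp
      linear_combination h2'
    · rw [mul_assoc, Complex.im_ofReal_mul, Complex.mul_im]
      simp [hty]
      field_simp
      right
      ring
  rw [logIntegrand, Complex.log_im, key, Complex.arg_mul_cos_add_sin_mul_I hr]
  constructor
  · linarith [Real.arctan_lt_pi_div_two u, Real.pi_pos]
  · linarith [Real.neg_pi_div_two_lt_arctan u]

theorem integrable_re {μ : Measure ℝ} {f : ℝ → ℂ} (hf : Integrable f μ) :
    Integrable (fun t => (f t).re) μ ∧ (∫ t, f t ∂μ).re = ∫ t, (f t).re ∂μ :=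
  ⟨Complex.reCLM.integrable_comp hf, (Complex.reCLM.integral_comp_comm hf).symm⟩

theorem integrable_im {μ : Measure ℝ} {f : ℝ → ℂ} (hf : Integrable f μ) :
    Integrable (fun t => (f t).im) μ ∧ (∫ t, f t ∂μ).im = ∫ t, (f t).im ∂μ :=
  ⟨Complex.imCLM.integrable_comp hf, (Complex.imCLM.integral_comp_comm hf).symm⟩

theorem IsWeight.re_cauchy (hν : IsWeight ν) (α β x : ℝ) {y : ℝ} (hy : y ≠ 0) :
    Integrable (fun t : ℝ => ((t - x) / (y ^ 2 + (x - t) ^ 2) - t / (1 + t ^ 2)) * ν t) ∧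
      (cauchyRep α β ν ⟨x, y⟩).re = α * x + β +
        ∫ t : ℝ, ((t - x) / (y ^ 2 + (x - t) ^ 2) - t / (1 + t ^ 2)) * ν t := by
  obtain ⟨h1, h2⟩ := integrable_re (hν.integrable_cauchyIntegrand (z := ⟨x, y⟩) hy)
  simp only [cauchyIntegrand_re] at h1 h2
  refine ⟨h1, ?_⟩
  rw [cauchyRep, Complex.add_re, h2]
  simp

theorem IsWeight.im_cauchy (hν : IsWeight ν) (α β x : ℝ) {y : ℝ} (hy : y ≠ 0) :
    Integrable (fun t : ℝ => y / (y ^ 2 + (x - t) ^ 2) * ν t) ∧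
      (cauchyRep α β ν ⟨x, y⟩).im = α * y + ∫ t : ℝ, y / (y ^ 2 + (x - t) ^ 2) * ν t := by
  obtain ⟨h1, h2⟩ := integrable_im (hν.integrable_cauchyIntegrand (z := ⟨x, y⟩) hy)
  simp only [cauchyIntegrand_im] at h1 h2
  refine ⟨h1, ?_⟩
  rw [cauchyRep, Complex.add_im, h2]
  simp

theorem IsWeight.re_log (hν : IsWeight ν) (α β x : ℝ) {y : ℝ} (hy : 0 < y) :
    Integrable (fun t : ℝ => Real.log √((1 + t ^ 2) / (y ^ 2 + (t - x) ^ 2)))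
        (lsMeasure ν hν.mono) ∧
      (cauchyRep α β ν ⟨x, y⟩).re = α * x + β +
        ∫ t : ℝ, Real.log √((1 + t ^ 2) / (y ^ 2 + (t - x) ^ 2)) ∂(lsMeasure ν hν.mono) := by
  obtain ⟨h1, h2⟩ := integrable_re (hν.integrable_logIntegrand (z := ⟨x, y⟩) hy.ne')
  simp only [logIntegrand_re] at h1 h2
  refine ⟨h1, ?_⟩
  rw [hν.cauchyRep_eq_logRep α β (z := ⟨x, y⟩) hy, logRep, Complex.add_re, h2]
  simp

theorem IsWeight.im_log (hν : IsWeight ν) (α β x : ℝ) {y : ℝ} (hy : 0 < y) :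
    Integrable (fun t : ℝ => Real.pi / 2 - Real.arctan ((t - x) / y)) (lsMeasure ν hν.mono) ∧
      (cauchyRep α β ν ⟨x, y⟩).im = α * y + Real.pi * negInf ν +
        ∫ t : ℝ, (Real.pi / 2 - Real.arctan ((t - x) / y)) ∂(lsMeasure ν hν.mono) := by
  obtain ⟨h1, h2⟩ := integrable_im (hν.integrable_logIntegrand (z := ⟨x, y⟩) hy.ne')
  simp only [logIntegrand_im x hy] at h1 h2
  refine ⟨h1, ?_⟩
  rw [hν.cauchyRep_eq_logRep α β (z := ⟨x, y⟩) hy, logRep, Complex.add_im, h2]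
  simp

/-! ### Boundary values of the imaginary part -/

theorem IsWeight.lsMeasure_Iio (hν : IsWeight ν) (x : ℝ) :
    lsMeasure ν hν.mono (Iio x) = ENNReal.ofReal (Function.leftLim ν x - negInf ν) := by
  rw [lsMeasure, StieltjesFunction.measure_Iio _ hν.tendsto_stieltjes]
  congr 2
  exact leftLim_rightLim (hν.mono.tendsto_leftLim x)

theorem lsMeasure_singleton (hν : Monotone ν) (x : ℝ) :
    lsMeasure ν hν {x} = ENNReal.ofReal (Function.rightLim ν x - Function.leftLim ν x) := by
  rw [lsMeasure, StieltjesFunction.measure_singleton, hν.stieltjesFunction_eq]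
  congr 2
  exact leftLim_rightLim (hν.tendsto_leftLim x)

theorem IsWeight.negInf_le_leftLim (hν : IsWeight ν) (x : ℝ) :
    negInf ν ≤ Function.leftLim ν x :=
  (hν.negInf_le (x - 1)).trans (hν.mono.le_leftLim (by linarith))

/-- The limit of `Im Φ` at `x` along the ray in the direction `c + i`. -/
theorem IsWeight.tendsto_im_ray (hν : IsWeight ν) (α β x c : ℝ) :
    Tendsto (fun y : ℝ => (cauchyRep α β ν ⟨x + c * y, y⟩).im) (𝓝[>] 0)
      (𝓝 (Real.pi * Function.leftLim ν x + (Real.pi / 2 + Real.arctan c) *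
        (Function.rightLim ν x - Function.leftLim ν x))) := by
  set μ := lsMeasure ν hν.mono with hμ
  have hfin : μ (Iic x) ≠ ⊤ := by rw [hν.lsMeasure_Iic]; exact ENNReal.ofReal_ne_top
  have hfin' : μ (Iio x) ≠ ⊤ := by rw [hν.lsMeasure_Iio]; exact ENNReal.ofReal_ne_top
  have hfin'' : μ {x} ≠ ⊤ := by rw [lsMeasure_singleton]; exact ENNReal.ofReal_ne_top
  -- The pointwise limit of the integrand: `π` left of `x`, `π/2 + arctan c` at `x`, and `0` right
  -- of `x`.
  let φ : ℝ → ℝ := fun t => (Iio x).indicator (fun _ => Real.pi) t +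
    ({x} : Set ℝ).indicator (fun _ => Real.pi / 2 + Real.arctan c) t
  have hint1 : Integrable ((Iio x).indicator fun _ => Real.pi) μ :=
    (integrable_indicator_iff measurableSet_Iio).2 (integrableOn_const hfin')
  have hint2 : Integrable (({x} : Set ℝ).indicator fun _ => Real.pi / 2 + Real.arctan c) μ :=
    (integrable_indicator_iff (measurableSet_singleton x)).2 (integrableOn_const hfin'')
  have hφ : ∫ t, φ t ∂μ = Real.pi * (Function.leftLim ν x - negInf ν) +
      (Real.pi / 2 + Real.arctan c) * (Function.rightLim ν x - Function.leftLim ν x) := by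
    rw [integral_add hint1 hint2, integral_indicator measurableSet_Iio,
      integral_indicator (measurableSet_singleton x), setIntegral_const, setIntegral_const,
      Measure.real, Measure.real, hν.lsMeasure_Iio, lsMeasure_singleton,
      ENNReal.toReal_ofReal (sub_nonneg.2 (hν.negInf_le_leftLim x)),
      ENNReal.toReal_ofReal (sub_nonneg.2 (hν.mono.leftLim_le_rightLim le_rfl))]
    simp only [smul_eq_mul]
    ring
  let f : ℝ → ℝ → ℝ := fun y t => Real.pi / 2 - Real.arctan ((t - (x + c * y)) / y)
  have hf : ∀ y : ℝ, 0 < y → ∀ t, f y t = Real.pi / 2 - Real.arctan ((t - x) / y - c) := by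
    intro y hy t
    simp only [f]
    congr 2
    field_simp
    ring
  -- Right of `x` the integrand increases with `y`, so for `y ≤ 1` its value at `y = 1` dominates;
  -- up to `x` the bound `π` suffices, since `(-∞, x]` has finite mass.
  let b : ℝ → ℝ := fun t => (Iic x).indicator (fun _ => Real.pi) t +
    (Real.pi / 2 - Real.arctan ((t - (x + c)) / 1))
  have hb : Integrable b μ :=
    ((integrable_indicator_iff measurableSet_Iic).2 (integrableOn_const hfin)).add
      (hν.im_log 0 0 (x + c) one_pos).1
  have hlim : Tendsto (fun y => ∫ t, f y t ∂μ) (𝓝[>] 0) (𝓝 (∫ t, φ t ∂μ)) := by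
    refine tendsto_integral_filter_of_dominated_convergence b ?_ ?_ hb ?_
    · refine Eventually.of_forall fun y => ?_
      exact (measurable_const.sub (Real.measurable_arctan.comp (by fun_prop))).aestronglyMeasurable
    · filter_upwards [Ioc_mem_nhdsGT (zero_lt_one' ℝ)] with y hy
      refine Eventually.of_forall fun t => ?_
      have h1 := Real.arctan_lt_pi_div_two ((t - x) / y - c)
      have h2 := Real.neg_pi_div_two_lt_arctan ((t - x) / y - c)
      have h3 := Real.arctan_lt_pi_div_two ((t - (x + c)) / 1)
      rw [hf y hy.1, Real.norm_eq_abs, abs_of_nonneg (by linarith)]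
      simp only [b]
      by_cases ht : t ∈ Iic x
      · rw [indicator_of_mem ht]
        linarith
      · rw [indicator_of_notMem ht, zero_add]
        have ht : x < t := by simpa using ht
        gcongr
        have : (t - x) ≤ (t - x) / y := by
          rw [le_div_iff₀ hy.1]
          exact mul_le_of_le_one_right (by linarith) hy.2
        linarith
    · refine Eventually.of_forall fun t => ?_
      have hcongr : (fun y => Real.pi / 2 - Real.arctan ((t - x) / y - c)) =ᶠ[𝓝[>] 0]
          fun y => f y t := by
        filter_upwards [self_mem_nhdsWithin] with y hy using (hf y hy t).symm
      refine Tendsto.congr' hcongr ?_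
      rcases lt_trichotomy t x with h | h | h
      · have h1 : φ t = Real.pi / 2 - -(Real.pi / 2) := by
          simp [φ, h, h.ne]
        rw [h1]
        refine tendsto_const_nhds.sub ?_
        refine (tendsto_nhds_of_tendsto_nhdsWithin Real.tendsto_arctan_atBot).comp ?_
        refine tendsto_atBot_add_const_right _ (-c) ?_
        exact tendsto_inv_nhdsGT_zero.const_mul_atTop_of_neg (r := t - x) (by linarith)
      -- At `t = x` the quotient is `0` for every `y`, and also at `y = 0` by the convention for
      -- division, so the integrand is constant.
      · have h1 : φ t = Real.pi / 2 - Real.arctan ((t - x) / 0 - c) := by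
          simp [φ, h]
        rw [h1]
        simp [h]
      · have h1 : φ t = Real.pi / 2 - (Real.pi / 2) := by
          simp [φ, h.le, h.ne']
        rw [h1]
        refine tendsto_const_nhds.sub ?_
        refine (tendsto_nhds_of_tendsto_nhdsWithin Real.tendsto_arctan_atTop).comp ?_
        refine tendsto_atTop_add_const_right _ (-c) ?_
        exact tendsto_inv_nhdsGT_zero.const_mul_atTop (r := t - x) (by linarith)
  have hid : Tendsto (fun y : ℝ => α * y + Real.pi * negInf ν) (𝓝[>] 0)
      (𝓝 (α * 0 + Real.pi * negInf ν)) :=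
    (Continuous.tendsto (by fun_prop) 0).mono_left nhdsWithin_le_nhds
  have h := hid.add hlim
  rw [hφ] at h
  have hval : α * 0 + Real.pi * negInf ν + (Real.pi * (Function.leftLim ν x - negInf ν) +
      (Real.pi / 2 + Real.arctan c) * (Function.rightLim ν x - Function.leftLim ν x)) =
      Real.pi * Function.leftLim ν x + (Real.pi / 2 + Real.arctan c) *
        (Function.rightLim ν x - Function.leftLim ν x) := by ring
  rw [hval] at h
  refine h.congr' ?_
  filter_upwards [self_mem_nhdsWithin] with y hy
  exact (hν.im_log α β (x + c * y) hy).2.symm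

theorem IsWeight.tendsto_im_vertical (hν : IsWeight ν) (α β x : ℝ) :
    Tendsto (fun y : ℝ => (cauchyRep α β ν ⟨x, y⟩).im) (𝓝[>] 0)
      (𝓝 (Real.pi * ((Function.rightLim ν x + Function.leftLim ν x) / 2))) := by
  have h := hν.tendsto_im_ray α β x 0
  simp only [zero_mul, add_zero, Real.arctan_zero] at h
  convert! h using 2
  ring

theorem tendsto_ray_stolzCone (x c : ℝ) :
    Tendsto (fun y : ℝ => (⟨x + c * y, y⟩ : ℂ)) (𝓝[>] 0)
      (𝓝[stolzCone x (|c| + 1)] (x : ℂ)) := by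
  refine tendsto_nhdsWithin_iff.2 ⟨?_, ?_⟩
  · have h : Continuous fun y : ℝ => (⟨x + c * y, y⟩ : ℂ) := by
      have : (fun y : ℝ => (⟨x + c * y, y⟩ : ℂ)) =
          fun y : ℝ => ((x + c * y : ℝ) : ℂ) + (y : ℂ) * Complex.I := by
        ext y
        rw [← Complex.mk_eq_add_mul_I]
      rw [this]
      fun_prop
    have h1 := (h.tendsto 0).mono_left (nhdsWithin_le_nhds (s := Ioi 0))
    convert! h1 using 2
    apply Complex.ext <;> simp
  · filter_upwards [self_mem_nhdsWithin] with y hy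
    have hy : (0 : ℝ) < y := hy
    refine ⟨hy, ?_⟩
    simp only [add_sub_cancel_left, abs_mul, abs_of_pos hy]
    linarith

/-- A non-tangential limit must agree along all rays, but the limits in the directions `i` and `1 +
i` differ by `π/4` times the jump. -/
theorem IsWeight.limitSet_im_subset (hν : IsWeight ν) (α β : ℝ) :
    limitSet (fun z => (cauchyRep α β ν z).im) ⊆ (jumpSet ν)ᶜ := by
  rintro x ⟨l, hl⟩ hx
  have hx : Function.leftLim ν x < Function.rightLim ν x := hx
  have h : ∀ c : ℝ, l = Real.pi * Function.leftLim ν x + (Real.pi / 2 + Real.arctan c) *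
        (Function.rightLim ν x - Function.leftLim ν x) := fun c =>
    tendsto_nhds_unique ((hl (|c| + 1) (by positivity)).comp (tendsto_ray_stolzCone x c))
      (hν.tendsto_im_ray α β x c)
  have h0 := h 0
  have h1 := h 1
  rw [Real.arctan_zero] at h0
  rw [Real.arctan_one] at h1
  nlinarith [mul_pos Real.pi_pos (sub_pos.2 hx)]

/-! ### Boundary values of the real part -/

theorem ae_lsMeasure_singleton_eq_zero (hν : Monotone ν) :
    ∀ᵐ x, lsMeasure ν hν {x} = 0 := by
  filter_upwards [hν.countable_not_continuousAt.ae_notMem (volume : Measure ℝ)] with x hx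
  have h : ContinuousAt ν x := by simpa using hx
  rw [lsMeasure_singleton, hν.continuousAt_iff_leftLim_eq_rightLim.1 h]
  simp

/-- The logarithmic potential of a locally finite measure on the line converges locally at almost
every point. -/
theorem ae_integrableOn_log_ball (μ : Measure ℝ) [IsLocallyFiniteMeasure μ] :
    ∀ᵐ x, IntegrableOn (fun t => Real.log (x - t)) (Metric.ball x 1) μ := by
  let g : ℝ → ℝ := (Metric.ball 0 1).indicator Real.log
  have hg : Integrable g := by
    refine (integrable_indicator_iff Metric.isOpen_ball.measurableSet).2 ?_
    rw [Real.ball_eq_Ioo]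
    refine IntegrableOn.mono_set ?_ Ioo_subset_Ioc_self
    have h := (intervalIntegral.intervalIntegrable_log' (a := 0 - 1) (b := 0 + 1)).1
    exact h
  -- Convolving an integrable function with a finite measure converges almost everywhere;
  -- restricting `μ` to balls makes it finite.
  have h : ∀ n : ℕ, ∀ᵐ x, Integrable (fun t => g (x - t))
      (μ.restrict (Metric.closedBall 0 n)) := by
    intro n
    have : IsFiniteMeasure (μ.restrict (Metric.closedBall (0 : ℝ) n)) :=
      ⟨by simpa using (isCompact_closedBall (0 : ℝ) n).measure_lt_top⟩
    have h1 := Integrable.ae_convolution_exists (ContinuousLinearMap.mul ℝ ℝ)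
      (integrable_const (1 : ℝ) : Integrable _ (μ.restrict (Metric.closedBall (0 : ℝ) n))) hg
    filter_upwards [h1] with x hx
    simpa [ConvolutionExistsAt] using hx
  filter_upwards [ae_all_iff.2 h] with x hx
  obtain ⟨n, hn⟩ := exists_nat_ge (|x| + 1)
  have hsub : Metric.ball x 1 ⊆ Metric.closedBall 0 n := by
    refine Metric.ball_subset_closedBall.trans (Metric.closedBall_subset_closedBall' ?_)
    rw [Real.dist_eq, sub_zero]
    linarith
  have hn' : IntegrableOn (fun t => g (x - t)) (Metric.closedBall 0 n) μ := hx n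
  refine (hn'.mono_set hsub).congr_fun (fun t ht => ?_)
    Metric.isOpen_ball.measurableSet
  refine indicator_of_mem ?_ _
  rw [mem_ball_zero_iff]
  rw [Metric.mem_ball, dist_comm] at ht
  exact ht

/-- An integrable majorant of `log |t-x| - log |t-z|` for `z` in the cone with vertex `x`. -/
noncomputable def coneMajorant (x k t : ℝ) : ℝ :=
  (Metric.ball x 1).indicator (fun t => |Real.log (x - t)| + (Real.log (k + 2) + Real.log 2)) t +
    ((Iic (x - 1)).indicator (fun _ => 1) t + (Ici (x + 1)).indicator (fun t => 1 / (t - x)) t)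

theorem IsWeight.integrable_coneMajorant (hν : IsWeight ν) {x : ℝ}
    (hx : IntegrableOn (fun t => Real.log (x - t)) (Metric.ball x 1) (lsMeasure ν hν.mono)) (k : ℝ) :
    Integrable (coneMajorant x k) (lsMeasure ν hν.mono) := by
  refine Integrable.add ?_ (Integrable.add ?_ ?_)
  · refine (integrable_indicator_iff Metric.isOpen_ball.measurableSet).2
      (hx.norm.add (integrableOn_const ?_))
    exact (measure_mono Metric.ball_subset_closedBall).trans_lt
      (isCompact_closedBall x 1).measure_lt_top |>.ne
  · refine (integrable_indicator_iff measurableSet_Iic).2 (integrableOn_const ?_)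
    rw [hν.lsMeasure_Iic]
    exact ENNReal.ofReal_ne_top
  · exact (integrable_indicator_iff measurableSet_Ici).2 (hν.integrableOn_inv_sub x)

/-- For `t` near `x`, the cone gives `‖z-x‖ ≤ (k+1) Im z`, hence `|t-x| ≤ (k+2)‖t-z‖`, while `‖t-z‖
≤ 2`. Away from `x`, `log r ≤ r - 1` applied to both quotients of the two distances gives `1/|t-x|`.
-/
theorem abs_log_sub_log_le_coneMajorant {x k : ℝ} (hk : 0 < k) {z : ℂ} (hz : z ∈ stolzCone x k)
    (hzx : ‖z - x‖ ≤ 1 / 2) {t : ℝ} (ht : t ≠ x) :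
    |Real.log |t - x| - Real.log ‖(t : ℂ) - z‖| ≤ coneMajorant x k t := by
  obtain ⟨hz0, hzk⟩ := hz
  have hr : 0 < |t - x| := abs_pos.2 (sub_ne_zero.2 ht)
  have hq : 0 < ‖(t : ℂ) - z‖ := norm_pos_iff.2 (ofReal_sub_ne_zero hz0.ne' t)
  have hnorm : ‖(t : ℂ) - x‖ = |t - x| := by
    rw [← Complex.ofReal_sub, Complex.norm_real, Real.norm_eq_abs]
  have h1 : |t - x| ≤ ‖(t : ℂ) - z‖ + ‖z - x‖ := by
    rw [← hnorm]; simpa using norm_add_le ((t : ℂ) - z) (z - x)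
  have h2 : ‖(t : ℂ) - z‖ ≤ |t - x| + ‖z - x‖ := by
    rw [← hnorm, norm_sub_rev z x]; simpa using norm_add_le ((t : ℂ) - x) (x - z)
  by_cases hb : t ∈ Metric.ball x 1
  · have hlt : |t - x| < 1 := by simpa [Real.dist_eq] using hb
    have e1 : t ∉ Iic (x - 1) := by
      rw [mem_Iic, not_le]; linarith [neg_abs_le (t - x)]
    have e2 : t ∉ Ici (x + 1) := by
      rw [mem_Ici, not_le]; linarith [le_abs_self (t - x)]
    rw [coneMajorant, indicator_of_mem hb, indicator_of_notMem e1, indicator_of_notMem e2]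
    have h3 : ‖z - x‖ ≤ (k + 1) * z.im := by
      have := Complex.norm_le_abs_re_add_abs_im (z - x)
      simp only [Complex.sub_re, Complex.ofReal_re, Complex.sub_im, Complex.ofReal_im, sub_zero,
        abs_of_pos hz0] at this
      linarith
    have h4 : z.im ≤ ‖(t : ℂ) - z‖ := by
      have := abs_im_le_norm_ofReal_sub z t
      rwa [abs_of_pos hz0] at this
    have h5 : |t - x| ≤ (k + 2) * ‖(t : ℂ) - z‖ := by
      nlinarith [mul_le_mul_of_nonneg_left h4 (by linarith : 0 ≤ k + 1)]
    have h6 := Real.log_le_log hr h5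
    rw [Real.log_mul (by linarith) hq.ne'] at h6
    have h7 : Real.log ‖(t : ℂ) - z‖ ≤ Real.log 2 := Real.log_le_log hq (by linarith)
    have h8 : Real.log (x - t) = Real.log |t - x| := by
      rw [abs_sub_comm, Real.log_abs]
    have h9 : 0 ≤ Real.log (k + 2) := Real.log_nonneg (by linarith)
    have h10 : 0 ≤ Real.log 2 := Real.log_nonneg (by norm_num)
    rw [h8, abs_le]
    constructor
    · linarith [neg_abs_le (Real.log |t - x|)]
    · linarith [abs_nonneg (Real.log |t - x|)]
  · have hge : 1 ≤ |t - x| := by simpa [Real.dist_eq] using hb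
    have h3 : |Real.log |t - x| - Real.log ‖(t : ℂ) - z‖| ≤ 1 / |t - x| := by
      rw [abs_le]
      constructor
      · have h4 := Real.log_le_sub_one_of_pos (div_pos hq hr)
        rw [Real.log_div hq.ne' hr.ne'] at h4
        have h5 : ‖(t : ℂ) - z‖ / |t - x| - 1 ≤ 1 / |t - x| := by
          rw [div_sub_one hr.ne']
          gcongr
          linarith
        linarith
      · have h4 := Real.log_le_sub_one_of_pos (div_pos hr hq)
        rw [Real.log_div hr.ne' hq.ne'] at h4
        have h5 : |t - x| / ‖(t : ℂ) - z‖ - 1 ≤ 1 / |t - x| := by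
          rw [div_sub_one hq.ne', div_le_div_iff₀ hq hr]
          nlinarith
        linarith
    refine h3.trans ?_
    rw [coneMajorant, indicator_of_notMem hb, zero_add]
    rcases le_abs.1 hge with h | h
    · have e1 : t ∉ Iic (x - 1) := by rw [mem_Iic, not_le]; linarith
      have e2 : t ∈ Ici (x + 1) := by rw [mem_Ici]; linarith
      rw [indicator_of_notMem e1, indicator_of_mem e2, abs_of_nonneg (by linarith), zero_add]
    · have e1 : t ∈ Iic (x - 1) := by rw [mem_Iic]; linarith
      have e2 : t ∉ Ici (x + 1) := by rw [mem_Ici, not_le]; linarith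
      rw [indicator_of_mem e1, indicator_of_notMem e2, add_zero, div_le_one hr]
      exact hge

theorem IsWeight.nontangential_re (hν : IsWeight ν) (α β : ℝ) {x : ℝ}
    (hx0 : lsMeasure ν hν.mono {x} = 0)
    (hx : IntegrableOn (fun t => Real.log (x - t)) (Metric.ball x 1) (lsMeasure ν hν.mono)) :
    Integrable (fun t : ℝ => Real.log (√(1 + t ^ 2) / |t - x|)) (lsMeasure ν hν.mono) ∧
      HasNontangentialLimit (fun z => (cauchyRep α β ν z).re) x
        (α * x + β + ∫ t : ℝ, Real.log (√(1 + t ^ 2) / |t - x|) ∂(lsMeasure ν hν.mono)) := by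
  set μ := lsMeasure ν hν.mono
  let d : ℂ → ℝ → ℝ := fun z t => Real.log |t - x| - Real.log ‖(t : ℂ) - z‖
  -- The majorant says nothing at `t = x`, where `Real.log 0 = 0` is a mere default; that point has
  -- no mass.
  have hne : ∀ᵐ t ∂μ, t ≠ x := by
    rw [ae_iff]
    simpa using hx0
  have hdm : ∀ z, AEStronglyMeasurable (d z) μ := by
    intro z
    refine Measurable.aestronglyMeasurable ?_
    refine (Real.measurable_log.comp (by fun_prop)).sub (Real.measurable_log.comp ?_)
    exact (Complex.measurable_ofReal.sub_const z).norm
  have hdle : ∀ k : ℝ, 0 < k → ∀ z ∈ stolzCone x k, ‖z - x‖ ≤ 1 / 2 →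
      ∀ᵐ t ∂μ, ‖d z t‖ ≤ coneMajorant x k t := by
    intro k hk z hz hzx
    filter_upwards [hne] with t ht using abs_log_sub_log_le_coneMajorant hk hz hzx ht
  have hdint : ∀ k : ℝ, 0 < k → ∀ z ∈ stolzCone x k, ‖z - x‖ ≤ 1 / 2 → Integrable (d z) μ :=
    fun k hk z hz hzx => (hν.integrable_coneMajorant hx k).mono' (hdm z) (hdle k hk z hz hzx)
  have hsplit : ∀ z : ℂ, 0 < z.im → ∀ᵐ t ∂μ,
      (logIntegrand z t).re = Real.log (√(1 + t ^ 2) / |t - x|) + d z t := by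
    intro z hz
    filter_upwards [hne] with t ht
    have h1 : √(1 + t ^ 2) ≠ 0 := (Real.sqrt_pos.2 (by positivity)).ne'
    rw [logIntegrand_re_eq, Real.log_div h1 (norm_ne_zero_iff.2 (ofReal_sub_ne_zero hz.ne' t)),
      Real.log_div h1 (abs_ne_zero.2 (sub_ne_zero.2 ht))]
    simp only [d]
    ring
  have hlog : ∀ z : ℂ, 0 < z.im → Integrable (fun t => (logIntegrand z t).re) μ := fun z hz =>
    (integrable_re (hν.integrable_logIntegrand hz.ne')).1
  have hint : Integrable (fun t : ℝ => Real.log (√(1 + t ^ 2) / |t - x|)) μ := by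
    -- One point of a cone suffices: the logarithmic integrand and `d z` are integrable there, hence
    -- so is their difference.
    let z : ℂ := ⟨x, 1 / 2⟩
    have hz : 0 < z.im := by simp [z]
    have hzx : ‖z - x‖ ≤ 1 / 2 := by
      have : z - x = ((1 / 2 : ℝ) : ℂ) * Complex.I := by
        apply Complex.ext <;> simp [z]
      rw [this, norm_mul, Complex.norm_I, Complex.norm_real]
      norm_num
    have h1 := hdint 1 one_pos z ⟨hz, by simp [z]⟩ hzx
    refine ((hlog z hz).sub h1).congr ?_
    filter_upwards [hsplit z hz] with t ht
    simp [ht]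
  refine ⟨hint, fun k hk => ?_⟩
  have hnhds : ∀ᶠ z in 𝓝[stolzCone x k] (x : ℂ), z ∈ stolzCone x k ∧ ‖z - x‖ ≤ 1 / 2 := by
    refine eventually_mem_nhdsWithin.and (mem_nhdsWithin_of_mem_nhds ?_)
    filter_upwards [Metric.closedBall_mem_nhds (x : ℂ) (by norm_num : (0 : ℝ) < 1 / 2)] with z hz
    rwa [Metric.mem_closedBall, dist_eq_norm] at hz
  have hd0 : Tendsto (fun z => ∫ t, d z t ∂μ) (𝓝[stolzCone x k] (x : ℂ))
      (𝓝 (∫ _ : ℝ, (0 : ℝ) ∂μ)) := by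
    refine tendsto_integral_filter_of_dominated_convergence (coneMajorant x k)
      (Eventually.of_forall hdm) ?_ (hν.integrable_coneMajorant hx k) ?_
    · filter_upwards [hnhds] with z hz using hdle k hk z hz.1 hz.2
    · filter_upwards [hne] with t ht
      have hne' : ‖(t : ℂ) - x‖ ≠ 0 := by
        rw [norm_ne_zero_iff, ← Complex.ofReal_sub, Complex.ofReal_ne_zero]
        exact sub_ne_zero.2 ht
      have h1 : ContinuousAt (fun z : ℂ => Real.log |t - x| - Real.log ‖(t : ℂ) - z‖) x :=
        continuousAt_const.sub (ContinuousAt.log (by fun_prop) hne')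
      have h2 := h1.tendsto.mono_left (nhdsWithin_le_nhds (s := stolzCone x k))
      rw [← Complex.ofReal_sub, Complex.norm_real, Real.norm_eq_abs, sub_self] at h2
      exact h2
  rw [integral_zero] at hd0
  have hre : Tendsto (fun z : ℂ => α * z.re + β +
      ∫ t : ℝ, Real.log (√(1 + t ^ 2) / |t - x|) ∂μ) (𝓝[stolzCone x k] (x : ℂ))
      (𝓝 (α * x + β + ∫ t : ℝ, Real.log (√(1 + t ^ 2) / |t - x|) ∂μ)) := by
    have h : Continuous (fun z : ℂ => α * z.re + β +
      ∫ t : ℝ, Real.log (√(1 + t ^ 2) / |t - x|) ∂μ) := by fun_prop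
    simpa using (h.tendsto (x : ℂ)).mono_left (nhdsWithin_le_nhds (s := stolzCone x k))
  have h := hre.add hd0
  rw [add_zero] at h
  refine h.congr' ?_
  filter_upwards [hnhds] with z hz
  rw [hν.cauchyRep_eq_logRep α β hz.1.1, logRep, Complex.add_re,
    (integrable_re (hν.integrable_logIntegrand hz.1.1.ne')).2, integral_congr_ae (hsplit z hz.1.1),
    integral_add hint (hdint k hk z hz.1 hz.2)]
  simp
  ring

/-! ### Uniqueness -/

theorem cauchyRep_congr {α β : ℝ} {ν₁ ν₂ : ℝ → ℝ} (h : ν₁ =ᵐ[volume] ν₂) (z : ℂ) :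
    cauchyRep α β ν₁ z = cauchyRep α β ν₂ z := by
  unfold cauchyRep
  congr 1
  refine integral_congr_ae ?_
  filter_upwards [h] with t ht
  simp [cauchyIntegrand, ht]

/-- Stieltjes inversion: vertical limits of the imaginary part recover `ν` at every continuity
point. The integrals then cancel, and the affine parts are compared at `i`. -/
theorem IsWeight.ext_of_cauchyRep {α₁ β₁ α₂ β₂ : ℝ} {ν₁ ν₂ : ℝ → ℝ} (h₁ : IsWeight ν₁)
    (h₂ : IsWeight ν₂) (h : ∀ z : ℂ, 0 < z.im → cauchyRep α₁ β₁ ν₁ z = cauchyRep α₂ β₂ ν₂ z) :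
    α₁ = α₂ ∧ β₁ = β₂ ∧ ν₁ =ᵐ[volume] ν₂ := by
  have hlim : ∀ x, Function.rightLim ν₁ x + Function.leftLim ν₁ x =
      Function.rightLim ν₂ x + Function.leftLim ν₂ x := by
    intro x
    have e := tendsto_nhds_unique (h₁.tendsto_im_vertical α₁ β₁ x)
      ((h₂.tendsto_im_vertical α₂ β₂ x).congr' (by
        filter_upwards [self_mem_nhdsWithin] with y hy
        rw [h ⟨x, y⟩ hy]))
    have e := mul_left_cancel₀ Real.pi_ne_zero e
    linarith
  have hae : ν₁ =ᵐ[volume] ν₂ := by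
    filter_upwards [h₁.mono.countable_not_continuousAt.ae_notMem (volume : Measure ℝ),
      h₂.mono.countable_not_continuousAt.ae_notMem (volume : Measure ℝ)] with x hx1 hx2
    have c1 : ContinuousAt ν₁ x := by simpa using hx1
    have c2 : ContinuousAt ν₂ x := by simpa using hx2
    have e := hlim x
    rw [h₁.mono.continuousWithinAt_Iio_iff_leftLim_eq.1 c1.continuousWithinAt,
      h₁.mono.continuousWithinAt_Ioi_iff_rightLim_eq.1 c1.continuousWithinAt,
      h₂.mono.continuousWithinAt_Iio_iff_leftLim_eq.1 c2.continuousWithinAt,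
      h₂.mono.continuousWithinAt_Ioi_iff_rightLim_eq.1 c2.continuousWithinAt] at e
    linarith
  have hlin : ∀ z : ℂ, 0 < z.im → (α₁ : ℂ) * z + β₁ = α₂ * z + β₂ := by
    intro z hz
    have e := h z hz
    rw [← cauchyRep_congr hae, cauchyRep, cauchyRep] at e
    exact add_right_cancel e
  have e := hlin Complex.I (by simp)
  have e1 := congrArg Complex.re e
  have e2 := congrArg Complex.im e
  simp at e1 e2
  exact ⟨e2, e1, hae⟩

/-! ### The first representation yields a Pick function with Pick derivative -/

theorem isOpen_im_ne_zero : IsOpen {z : ℂ | z.im ≠ 0} :=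
  isOpen_ne_fun Complex.continuous_im continuous_const

theorem isOpen_im_pos : IsOpen {z : ℂ | 0 < z.im} :=
  isOpen_lt continuous_const Complex.continuous_im

/-- Write `1 + t² = |t+i|²` and absorb `|z+i|` into a multiple of `|t-z| ≥ |Im z|`. -/
theorem one_add_sq_le_norm_sq {z : ℂ} (hz : z.im ≠ 0) (t : ℝ) :
    1 + t ^ 2 ≤ (1 + (‖z‖ + 1) / |z.im|) ^ 2 * ‖(t : ℂ) - z‖ ^ 2 := by
  have hy : 0 < |z.im| := abs_pos.2 hz
  have h1 : ‖(t : ℂ) + Complex.I‖ ^ 2 = 1 + t ^ 2 := by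
    rw [Complex.sq_norm, Complex.normSq_apply]
    simp
    ring
  have h2 : ‖(t : ℂ) + Complex.I‖ ≤ ‖(t : ℂ) - z‖ + (‖z‖ + 1) := by
    have e : (t : ℂ) + Complex.I = ((t : ℂ) - z) + (z + Complex.I) := by ring
    rw [e]
    refine (norm_add_le _ _).trans (add_le_add_right ((norm_add_le _ _).trans ?_) _)
    rw [Complex.norm_I]
  have h3 : ‖z‖ + 1 ≤ (‖z‖ + 1) / |z.im| * ‖(t : ℂ) - z‖ := by
    rw [div_mul_eq_mul_div, le_div_iff₀ hy]
    exact mul_le_mul_of_nonneg_left (abs_im_le_norm_ofReal_sub z t) (by positivity)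
  rw [← h1, ← mul_pow]
  refine pow_le_pow_left₀ (norm_nonneg _) (h2.trans ?_) 2
  linarith

theorem IsWeight.differentiableAt_cauchyRep (hν : IsWeight ν) (α β : ℝ) {z : ℂ} (hz : z.im ≠ 0) :
    DifferentiableAt ℂ (cauchyRep α β ν) z := by
  have hy : 0 < |z.im| := abs_pos.2 hz
  -- Within half the distance to the axis, `|t-z|` and `|t-w|` are comparable uniformly in `t`, so
  -- one bound dominates all the derivatives.
  have hball : ∀ w ∈ Metric.ball z (|z.im| / 2), w.im ≠ 0 ∧
      ∀ t : ℝ, ‖(t : ℂ) - z‖ ≤ 2 * ‖(t : ℂ) - w‖ := by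
    intro w hw
    rw [mem_ball_iff_norm] at hw
    constructor
    · intro h
      have := Complex.abs_im_le_norm (w - z)
      rw [Complex.sub_im, h, zero_sub, abs_neg] at this
      linarith
    · intro t
      have h1 := abs_im_le_norm_ofReal_sub z t
      have h2 : ‖(t : ℂ) - z‖ ≤ ‖(t : ℂ) - w‖ + ‖w - z‖ := by
        simpa using norm_add_le ((t : ℂ) - w) (w - z)
      linarith
  set K := (1 + (‖z‖ + 1) / |z.im|) ^ 2
  have hmain := hasDerivAt_integral_of_dominated_loc_of_deriv_le (μ := (volume : Measure ℝ))
    (F := fun w t => cauchyIntegrand ν w t) (x₀ := z) (s := Metric.ball z (|z.im| / 2))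
    (F' := fun w t => 1 / ((t : ℂ) - w) ^ 2 * (ν t : ℂ))
    (bound := fun t => 4 * K * ((1 + t ^ 2)⁻¹ * ν t))
    (Metric.ball_mem_nhds z (by positivity)) ?_ (hν.integrable_cauchyIntegrand hz) ?_ ?_
    (hν.integrable_inv_one_add_sq_mul.const_mul _) ?_
  · have h : cauchyRep α β ν = fun w => (α * w + β) + ∫ t : ℝ, cauchyIntegrand ν w t := rfl
    rw [h]
    exact DifferentiableAt.add (by fun_prop) hmain.2.differentiableAt
  · filter_upwards [isOpen_im_ne_zero.mem_nhds hz] with w hw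
    exact (hν.integrable_cauchyIntegrand hw).aestronglyMeasurable
  · have := hν.mono.measurable
    exact Measurable.aestronglyMeasurable (by fun_prop)
  · refine Eventually.of_forall fun t w hw => ?_
    obtain ⟨hw0, hw1⟩ := hball w hw
    have h0 : 0 < ‖(t : ℂ) - w‖ := norm_pos_iff.2 (ofReal_sub_ne_zero hw0 t)
    have h1 := one_add_sq_le_norm_sq hz t
    have h2 : ‖(t : ℂ) - z‖ ^ 2 ≤ 4 * ‖(t : ℂ) - w‖ ^ 2 := by
      have := pow_le_pow_left₀ (norm_nonneg _) (hw1 t) 2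
      linarith [mul_pow 2 ‖(t : ℂ) - w‖ 2]
    have h3 : 1 + t ^ 2 ≤ 4 * K * ‖(t : ℂ) - w‖ ^ 2 := by
      have hK : 0 ≤ K := by positivity
      nlinarith [mul_le_mul_of_nonneg_left h2 hK]
    rw [norm_mul, norm_div, norm_one, norm_pow, Complex.norm_real, Real.norm_eq_abs,
      abs_of_nonneg (hν.nonneg t), ← mul_assoc]
    refine mul_le_mul_of_nonneg_right ?_ (hν.nonneg t)
    rw [← div_eq_mul_inv, div_le_div_iff₀ (by positivity) (by positivity)]
    linarith
  · refine Eventually.of_forall fun t w hw => ?_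
    have h0 := ofReal_sub_ne_zero (hball w hw).1 t
    have h1 := (((hasDerivAt_id w).const_sub (t : ℂ)).inv h0).sub_const
      ((t : ℂ) / (1 + (t : ℂ) ^ 2))
    have h2 := h1.mul_const (ν t : ℂ)
    simpa [cauchyIntegrand] using! h2

theorem hasDerivAt_im_horizontal {f : ℂ → ℂ} {x y : ℝ} (hf : DifferentiableAt ℂ f ⟨x, y⟩) :
    HasDerivAt (fun s : ℝ => (f ⟨s, y⟩).im) (deriv f ⟨x, y⟩).im x := by
  have h1 : HasDerivAt (fun s : ℝ => (s : ℂ) + y * Complex.I) 1 x :=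
    (Complex.ofRealCLM.hasDerivAt (x := x)).add_const _
  have e : ∀ s : ℝ, (⟨s, y⟩ : ℂ) = (s : ℂ) + y * Complex.I := fun s => by
    rw [← Complex.mk_eq_add_mul_I]
  simp only [e] at hf ⊢
  have h2 := hf.hasDerivAt.comp x h1
  rw [mul_one] at h2
  exact Complex.imCLM.hasFDerivAt.comp_hasDerivAt x h2

/-- After `t = x - s` only the translate `ν(x-s)` depends on `x`, and the kernel is positive. -/
theorem IsWeight.monotone_im_cauchyRep (hν : IsWeight ν) (α β : ℝ) {y : ℝ} (hy : 0 < y) :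
    Monotone fun x : ℝ => (cauchyRep α β ν ⟨x, y⟩).im := by
  have h : ∀ x, Integrable (fun s => y / (y ^ 2 + s ^ 2) * ν (x - s)) ∧
      (cauchyRep α β ν ⟨x, y⟩).im = α * y + ∫ s, y / (y ^ 2 + s ^ 2) * ν (x - s) := by
    intro x
    obtain ⟨h1, h2⟩ := hν.im_cauchy α β x hy.ne'
    have h3 := integral_sub_left_eq_self (fun t => y / (y ^ 2 + (x - t) ^ 2) * ν t) volume x
    have h4 := h1.comp_sub_left x
    simp only [sub_sub_cancel] at h3 h4
    exact ⟨h4, by rw [h3]; exact h2⟩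
  intro a b hab
  change (cauchyRep α β ν ⟨a, y⟩).im ≤ (cauchyRep α β ν ⟨b, y⟩).im
  rw [(h a).2, (h b).2]
  gcongr
  · exact (h a).1
  · exact (h b).1
  · intro s
    have : ν (a - s) ≤ ν (b - s) := hν.mono (by linarith)
    dsimp only
    gcongr

theorem conj_cauchyRep (α β : ℝ) (ν : ℝ → ℝ) (z : ℂ) :
    conj (cauchyRep α β ν (conj z)) = cauchyRep α β ν z := by
  unfold cauchyRep
  rw [map_add, ← integral_conj]
  simp [cauchyIntegrand]

theorem ReflectionSymmetric.eventuallyEq {Φ : ℂ → ℂ} (h : ReflectionSymmetric Φ) {z : ℂ}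
    (hz : z.im < 0) : Φ =ᶠ[𝓝 z] conj ∘ Φ ∘ conj := by
  filter_upwards [(isOpen_lt Complex.continuous_im continuous_const).mem_nhds hz] with w hw
  exact h w hw

theorem ReflectionSymmetric.deriv {Φ : ℂ → ℂ} (h : ReflectionSymmetric Φ) :
    ReflectionSymmetric (deriv Φ) := by
  intro z hz
  rw [(h.eventuallyEq hz).deriv_eq, deriv_conj_conj]
  rfl

theorem mem_primClass_of_cauchyRep {Φ : ℂ → ℂ} {α β : ℝ} (hα : 0 ≤ α) (hν : IsWeight ν)
    (h : ∀ z : ℂ, z.im ≠ 0 → Φ z = cauchyRep α β ν z) : Φ ∈ primClass := by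
  have hd : ∀ z : ℂ, z.im ≠ 0 → DifferentiableAt ℂ Φ z := by
    intro z hz
    refine (hν.differentiableAt_cauchyRep α β hz).congr_of_eventuallyEq ?_
    filter_upwards [isOpen_im_ne_zero.mem_nhds hz] with w hw using h w hw
  have hholo : DifferentiableOn ℂ Φ {z : ℂ | z.im ≠ 0} :=
    fun z hz => (hd z hz).differentiableWithinAt
  have hsymm : ReflectionSymmetric Φ := by
    intro z hz
    rw [h z hz.ne, h (conj z) (by simpa using hz.ne), conj_cauchyRep]
  have hpos : ∀ z : ℂ, 0 < z.im → 0 ≤ (deriv Φ z).im := by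
    intro z hz
    have h1 := hasDerivAt_im_horizontal (x := z.re) (y := z.im) (hd ⟨z.re, z.im⟩ hz.ne')
    refine h1.nonneg_of_monotone ?_
    have e : (fun s : ℝ => (Φ ⟨s, z.im⟩).im) = fun s => (cauchyRep α β ν ⟨s, z.im⟩).im :=
      funext fun s => by rw [h ⟨s, z.im⟩ hz.ne']
    rw [e]
    exact hν.monotone_im_cauchyRep α β hz
  refine ⟨⟨hholo, fun z hz => ?_, hsymm⟩, ⟨hholo.deriv isOpen_im_ne_zero, fun z hz => ?_,
    hsymm.deriv⟩⟩
  · obtain ⟨x, y⟩ := z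
    have hz : y ≠ 0 := hz
    rw [h ⟨x, y⟩ hz, (hν.im_cauchy α β x hz).2]
    -- Pulling out `y` treats both half-planes at once.
    have h1 : ∫ t : ℝ, y / (y ^ 2 + (x - t) ^ 2) * ν t =
        y * ∫ t : ℝ, 1 / (y ^ 2 + (x - t) ^ 2) * ν t := by
      rw [← integral_const_mul]
      congr 1
      ext t
      ring
    have h2 : 0 ≤ ∫ t : ℝ, 1 / (y ^ 2 + (x - t) ^ 2) * ν t :=
      integral_nonneg fun t => mul_nonneg (by positivity) (hν.nonneg t)
    rw [h1]
    have h3 : (α * y + y * ∫ t : ℝ, 1 / (y ^ 2 + (x - t) ^ 2) * ν t) / y =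
        α + ∫ t : ℝ, 1 / (y ^ 2 + (x - t) ^ 2) * ν t := by
      field_simp
    change 0 ≤ _ / y
    rw [h3]
    positivity
  · rcases lt_or_gt_of_ne hz with hz | hz
    · rw [hsymm.deriv z hz, Complex.conj_im]
      exact div_nonneg_of_nonpos (neg_nonpos.2 (hpos _ (by simpa using hz))) hz.le
    · exact div_nonneg (hpos z hz) hz.le

/-! ### Pick functions with Pick derivative have the first representation -/

/-- Monotone and bounded below, `g` has a limit `l` at `-∞`, and the fundamental theorem of calculus
applies from there. -/
theorem exists_lintegral_Iic_deriv {g g' : ℝ → ℝ} (hd : ∀ x, HasDerivAt g (g' x) x)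
    (hc : Continuous g') (hg' : ∀ x, 0 ≤ g' x) (hg : ∀ x, 0 ≤ g x) :
    ∃ l, 0 ≤ l ∧ ∀ x, l ≤ g x ∧ ∫⁻ s in Iic x, ENNReal.ofReal (g' s) = ENNReal.ofReal (g x - l) := by
  have hmono : Monotone g := monotone_of_hasDerivAt_nonneg hd hg'
  have hbdd : BddBelow (range g) := ⟨0, by rintro _ ⟨t, rfl⟩; exact hg t⟩
  have hl := tendsto_atBot_ciInf hmono hbdd
  refine ⟨⨅ i, g i, le_ciInf hg, fun x => ⟨ciInf_le hbdd x, ?_⟩⟩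
  have hint : IntegrableOn g' (Iic x) := by
    refine integrableOn_Iic_of_intervalIntegral_norm_tendsto (g x - ⨅ i, g i) x
      (fun i => (hc.integrableOn_Icc).mono_set Ioc_subset_Icc_self) tendsto_id (l := atBot) ?_
    refine (tendsto_const_nhds.sub hl).congr fun i => ?_
    have e : ∀ s, ‖g' s‖ = g' s := fun s => by rw [Real.norm_eq_abs, abs_of_nonneg (hg' s)]
    simp only [e, id]
    exact (intervalIntegral.integral_eq_sub_of_hasDerivAt (fun s _ => hd s)
      (hc.intervalIntegrable _ _)).symm
  rw [← integral_Iic_of_hasDerivAt_of_tendsto' (fun s _ => hd s) hint hl,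
    ofReal_integral_eq_lintegral_ofReal hint (Eventually.of_forall hg')]

/-- Tonelli's theorem for the Poisson integral of a measure, integrated over a half-line. -/
theorem lintegral_Iic_poisson (μ : Measure ℝ) [SFinite μ] (x y : ℝ) :
    ∫⁻ s in Iic x, ∫⁻ τ, ENNReal.ofReal (y / (y ^ 2 + (s - τ) ^ 2)) ∂μ =
      ∫⁻ t, ENNReal.ofReal (y / (y ^ 2 + (x - t) ^ 2)) * μ (Iic t) := by
  have hm : Measurable fun p : ℝ × ℝ => ENNReal.ofReal (y / (y ^ 2 + (p.1 - p.2) ^ 2)) := by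
    fun_prop
  rw [lintegral_lintegral_swap hm.aemeasurable]
  have h1 : ∀ τ : ℝ, ∫⁻ s in Iic x, ENNReal.ofReal (y / (y ^ 2 + (s - τ) ^ 2)) =
      ∫⁻ t, (Iic t).indicator (fun _ => ENNReal.ofReal (y / (y ^ 2 + (x - t) ^ 2))) τ := by
    intro τ
    -- The substitution `s = x + τ - t` turns `s - τ` into `x - t` and `s ≤ x` into `τ ≤ t`.
    rw [← lintegral_indicator measurableSet_Iic, ← lintegral_sub_left_eq_self _ (x + τ)]
    congr 1
    ext t
    by_cases h : τ ≤ t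
    · rw [indicator_of_mem (mem_Iic.2 h), indicator_of_mem (mem_Iic.2 (by linarith))]
      congr 4
      ring
    · rw [indicator_of_notMem (by simpa using h), indicator_of_notMem (by
        simp only [mem_Iic, not_le] at h ⊢; linarith)]
  simp only [h1]
  have hm2 : Measurable fun p : ℝ × ℝ =>
      (Iic p.2).indicator (fun _ => ENNReal.ofReal (y / (y ^ 2 + (x - p.2) ^ 2))) p.1 := by
    have e : (fun p : ℝ × ℝ =>
        (Iic p.2).indicator (fun _ => ENNReal.ofReal (y / (y ^ 2 + (x - p.2) ^ 2))) p.1) =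
        {p : ℝ × ℝ | p.1 ≤ p.2}.indicator
          (fun p => ENNReal.ofReal (y / (y ^ 2 + (x - p.2) ^ 2))) := by
      ext p
      by_cases h : p.1 ≤ p.2 <;> simp [h]
    rw [e]
    exact Measurable.indicator (by fun_prop) (measurableSet_le measurable_fst measurable_snd)
  rw [lintegral_lintegral_swap (f := fun τ t =>
    (Iic t).indicator (fun _ => ENNReal.ofReal (y / (y ^ 2 + (x - t) ^ 2))) τ) hm2.aemeasurable]
  congr 1
  ext t
  rw [lintegral_indicator measurableSet_Iic, setLIntegral_const]

theorem isWeight_of_integrable {ν : ℝ → ℝ} (h0 : ∀ t, 0 ≤ ν t) (hm : Monotone ν)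
    (hi : Integrable fun t => (1 + t ^ 2)⁻¹ * ν t) : IsWeight ν := by
  refine ⟨h0, hm, ?_⟩
  refine (hi.const_mul 2).integrableOn.mono' ?_ ?_
  · have := hm.measurable
    exact Measurable.aestronglyMeasurable (by fun_prop)
  · refine (ae_restrict_iff' measurableSet_Ioi).2 (Eventually.of_forall fun t ht => ?_)
    have ht : (1 : ℝ) < t := ht
    have h1 : (t ^ 2)⁻¹ ≤ 2 * (1 + t ^ 2)⁻¹ := by
      rw [← div_eq_mul_inv, inv_eq_one_div, div_le_div_iff₀ (by positivity) (by positivity)]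
      nlinarith
    rw [Real.norm_eq_abs, abs_of_nonneg (div_nonneg (h0 t) (by positivity)), ← mul_assoc,
      div_eq_mul_inv, mul_comm]
    exact mul_le_mul_of_nonneg_right h1 (h0 t)

theorem IsWeight.add_const {ν : ℝ → ℝ} (hν : IsWeight ν) {c : ℝ} (hc : 0 ≤ c) :
    IsWeight fun t => ν t + c := by
  refine isWeight_of_integrable (fun t => add_nonneg (hν.nonneg t) hc)
    (hν.mono.add_const c) ?_
  simpa only [mul_add] using! hν.integrable_inv_one_add_sq_mul.add
    (integrable_inv_one_add_sq.mul_const c)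

theorem IsWeight.integral_cauchyIntegrand_add_const {ν : ℝ → ℝ} (hν : IsWeight ν) (c : ℝ) {z : ℂ}
    (hz : 0 < z.im) : ∫ t, cauchyIntegrand (fun t => ν t + c) z t =
      (∫ t, cauchyIntegrand ν z t) + c * (Real.pi * Complex.I) := by
  rw [← integral_kernel hz, ← integral_const_mul, ← integral_add
    (hν.integrable_cauchyIntegrand hz.ne') ((integrable_kernel hz.ne').const_mul _)]
  congr 1
  ext t
  simp [cauchyIntegrand, kernel]
  ring

/-- The weight of a function `Φ` with `Im Φ ≥ 0` and `Im Φ' ≥ 0` in the half-plane. -/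
theorem exists_weight_of_im_nonneg {Φ : ℂ → ℂ} (hΦ : DifferentiableOn ℂ Φ {z | 0 < z.im})
    (him : ∀ z : ℂ, 0 < z.im → 0 ≤ (Φ z).im) (him' : ∀ z : ℂ, 0 < z.im → 0 ≤ (deriv Φ z).im) :
    ∃ (ν : ℝ → ℝ) (g : ℝ → ℝ), IsWeight ν ∧ (∀ y, 0 < y → 0 ≤ g y) ∧
      ∀ x y, 0 < y → (Φ ⟨x, y⟩).im = (cauchyRep 0 0 ν ⟨x, y⟩).im + g y := by
  have hd := hΦ.deriv isOpen_im_pos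
  obtain ⟨a, μ, hμ, ha, hrep⟩ := exists_measure_im_eq_poisson hd him'
  have hstep : ∀ y : ℝ, 0 < y → ∃ l, 0 ≤ l ∧ ∀ x, l ≤ (Φ ⟨x, y⟩).im ∧
      ∫⁻ s in Iic x, ENNReal.ofReal (deriv Φ ⟨s, y⟩).im =
        ENNReal.ofReal ((Φ ⟨x, y⟩).im - l) := by
    intro y hy
    refine exists_lintegral_Iic_deriv (g := fun x => (Φ ⟨x, y⟩).im)
      (fun x => hasDerivAt_im_horizontal (hΦ.differentiableAt (isOpen_im_pos.mem_nhds hy))) ?_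
      (fun x => him' ⟨x, y⟩ hy) (fun x => him ⟨x, y⟩ hy)
    refine Complex.continuous_im.comp (hd.continuousOn.comp_continuous ?_ fun x => hy)
    have e : (fun s : ℝ => (⟨s, y⟩ : ℂ)) = fun s : ℝ => (s : ℂ) + y * Complex.I :=
      funext fun s => by rw [← Complex.mk_eq_add_mul_I]
    rw [e]
    fun_prop
  choose! g hg0 hg using hstep
  -- Otherwise `Im Φ'` is at least `a` on the line `y = 1`, and its integral over a half-line is
  -- infinite.
  have ha0 : a = 0 := by
    by_contra hne
    have hapos : 0 < a := lt_of_le_of_ne ha (Ne.symm hne)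
    have h1 : ∫⁻ _ in Iic (0 : ℝ), ENNReal.ofReal (a * 1) ≤
        ∫⁻ s in Iic (0 : ℝ), ENNReal.ofReal (deriv Φ ⟨s, 1⟩).im := by
      refine lintegral_mono fun s => ?_
      rw [hrep s 1 one_pos]
      exact le_self_add
    rw [(hg 1 one_pos 0).2, setLIntegral_const, Real.volume_Iic, ENNReal.mul_top (by simpa)] at h1
    exact absurd h1 (by simp)
  have hkey : ∀ x y, 0 < y → ∫⁻ t, ENNReal.ofReal (y / (y ^ 2 + (x - t) ^ 2)) * μ (Iic t) =
      ENNReal.ofReal ((Φ ⟨x, y⟩).im - g y) := by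
    intro x y hy
    rw [← (hg y hy x).2, ← lintegral_Iic_poisson]
    refine lintegral_congr fun s => ?_
    rw [hrep s y hy, ha0]
    simp
  have hmonoI : Monotone fun t => μ (Iic t) := fun s t h => measure_mono (Iic_subset_Iic.2 h)
  -- A finite integral against a positive kernel makes `μ (Iic s)` finite for almost every `s`; some
  -- such `s` lies beyond `t`.
  have hfin : ∀ t, μ (Iic t) ≠ ⊤ := by
    intro t
    have h1 : ∀ᵐ s, ENNReal.ofReal (1 / (1 ^ 2 + (0 - s) ^ 2)) * μ (Iic s) < ⊤ := by
      refine ae_lt_top ((by fun_prop : Measurable fun s : ℝ =>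
        ENNReal.ofReal (1 / (1 ^ 2 + (0 - s) ^ 2))).mul hmonoI.measurable) ?_
      rw [hkey 0 1 one_pos]
      exact ENNReal.ofReal_ne_top
    have hne : NeBot (ae (volume.restrict (Ioi t))) := by
      rw [ae_neBot, Ne, Measure.restrict_eq_zero]
      simp
    obtain ⟨s, hs, hts⟩ :=
      ((ae_restrict_of_ae (s := Ioi t) h1).and (ae_restrict_mem measurableSet_Ioi)).exists
    have hpos : ENNReal.ofReal (1 / (1 ^ 2 + (0 - s) ^ 2)) ≠ 0 := by
      rw [Ne, ENNReal.ofReal_eq_zero, not_le]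
      positivity
    refine ne_top_of_le_ne_top (fun h => ?_) (hmonoI (le_of_lt hts))
    have h : μ (Iic s) = ⊤ := h
    rw [h, ENNReal.mul_top hpos] at hs
    exact lt_irrefl _ hs
  let ν : ℝ → ℝ := fun t => μ.real (Iic t)
  have hν0 : ∀ t, 0 ≤ ν t := fun t => measureReal_nonneg
  have hνm : Monotone ν := fun s t h => measureReal_mono (Iic_subset_Iic.2 h) (hfin t)
  have hνme := hνm.measurable
  have hlint : ∀ x y, 0 < y → ∫⁻ t, ENNReal.ofReal (y / (y ^ 2 + (x - t) ^ 2) * ν t) =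
      ENNReal.ofReal ((Φ ⟨x, y⟩).im - g y) := by
    intro x y hy
    rw [← hkey x y hy]
    refine lintegral_congr fun t => ?_
    rw [ENNReal.ofReal_mul (by positivity), ofReal_measureReal (hfin t)]
  have hnn : ∀ x y, 0 < y → ∀ t, 0 ≤ y / (y ^ 2 + (x - t) ^ 2) * ν t := fun x y hy t =>
    mul_nonneg (by positivity) (hν0 t)
  have hmeas : ∀ x y, AEStronglyMeasurable (fun t => y / (y ^ 2 + (x - t) ^ 2) * ν t) volume :=
    fun x y => Measurable.aestronglyMeasurable (by fun_prop)
  have hw : IsWeight ν := by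
    refine isWeight_of_integrable hν0 hνm ?_
    have h1 : Integrable (fun t => 1 / (1 ^ 2 + (0 - t) ^ 2) * ν t) := by
      refine ⟨hmeas 0 1, ?_⟩
      rw [hasFiniteIntegral_iff_ofReal (Eventually.of_forall (hnn 0 1 one_pos)),
        hlint 0 1 one_pos]
      exact ENNReal.ofReal_lt_top
    simpa using h1
  refine ⟨ν, g, hw, hg0, fun x y hy => ?_⟩
  rw [(hw.im_cauchy 0 0 x hy.ne').2, integral_eq_lintegral_of_nonneg_ae
    (Eventually.of_forall (hnn x y hy)) (hmeas x y), hlint x y hy,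
    ENNReal.toReal_ofReal (sub_nonneg.2 (hg y hy x).1)]
  ring

theorem isConnected_im_pos : IsConnected {z : ℂ | 0 < z.im} :=
  (convex_halfSpace_im_gt 0).isConnected ⟨Complex.I, by simp⟩

/-- A holomorphic function in the half-plane whose imaginary part depends on `Im z` only is affine
with real slope. -/
theorem exists_eq_affine_of_im_horizontal {G : ℂ → ℂ} (hG : DifferentiableOn ℂ G {z | 0 < z.im})
    {g : ℝ → ℝ} (h : ∀ x y, 0 < y → (G ⟨x, y⟩).im = g y) :
    ∃ (α : ℝ) (c : ℂ), ∀ z : ℂ, 0 < z.im → G z = α * z + c := by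
  have hd := hG.deriv isOpen_im_pos
  have him : ∀ z ∈ {z : ℂ | 0 < z.im}, (deriv G z).im = 0 := by
    rintro ⟨x, y⟩ hz
    have h1 := hasDerivAt_im_horizontal (hG.differentiableAt (isOpen_im_pos.mem_nhds hz))
    have hz : 0 < y := hz
    have e : (fun s : ℝ => (G ⟨s, y⟩).im) = fun _ => g y := funext fun s => h s y hz
    rw [e] at h1
    exact h1.unique (hasDerivAt_const x (g y))
  -- A holomorphic function with vanishing imaginary part on a connected open set is a real
  -- constant.
  obtain ⟨α, hα⟩ := (hd.analyticOnNhd isOpen_im_pos).eq_const_add_im_mul_I_of_re_eq_const him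
    isOpen_im_pos isConnected_im_pos
  obtain ⟨c, hc⟩ := isOpen_im_pos.exists_is_const_of_deriv_eq_zero
    isConnected_im_pos.isPreconnected (f := fun z => G z - α * z)
    (hG.sub (by fun_prop)) (fun z hz => by
      have h1 := (hG.differentiableAt (isOpen_im_pos.mem_nhds hz)).hasDerivAt
      have h2 := (h1.sub ((hasDerivAt_id z).const_mul (α : ℂ))).deriv
      rw [hα z hz] at h2
      simpa using! h2)
  exact ⟨α, c, fun z hz => by rw [← hc z hz]; ring⟩

theorem affine_nonneg {α γ : ℝ} (h : ∀ y : ℝ, 0 < y → 0 ≤ α * y + γ) : 0 ≤ α ∧ 0 ≤ γ := by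
  constructor
  · by_contra! hα
    -- At this `y` the affine function is `γ - |γ| - 1 < 0`.
    have h1 := h ((|γ| + 1) / (-α)) (div_pos (by positivity) (by linarith))
    have h2 : α * ((|γ| + 1) / (-α)) = -(|γ| + 1) := by
      have := hα.ne
      field_simp
    linarith [le_abs_self γ]
  · refine ge_of_tendsto (f := fun y : ℝ => α * y + γ) (x := 𝓝[>] 0) ?_ ?_
    · have : Continuous fun y : ℝ => α * y + γ := by fun_prop
      simpa using (this.tendsto 0).mono_left (nhdsWithin_le_nhds (s := Ioi 0))
    · filter_upwards [self_mem_nhdsWithin] with y hy using h y hy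

theorem exists_cauchyRep_of_mem_primClass {Φ : ℂ → ℂ} (h : Φ ∈ primClass) :
    ∃ (α β : ℝ) (ν : ℝ → ℝ), 0 ≤ α ∧ IsWeight ν ∧
      ∀ z : ℂ, z.im ≠ 0 → Φ z = cauchyRep α β ν z := by
  obtain ⟨h1, h2⟩ := h
  have hpos : ∀ {F : ℂ → ℂ}, IsPick F → ∀ z : ℂ, 0 < z.im → 0 ≤ (F z).im := by
    intro F hF z hz
    have := mul_nonneg (hF.im_div_im_nonneg z hz.ne') hz.le
    rwa [div_mul_cancel₀ _ hz.ne'] at this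
  have hΦ : DifferentiableOn ℂ Φ {z | 0 < z.im} :=
    h1.holo.mono fun z (hz : 0 < z.im) => hz.ne'
  obtain ⟨ν, g, hν, hg, hrep⟩ := exists_weight_of_im_nonneg hΦ (hpos h1) (hpos h2)
  have hG : DifferentiableOn ℂ (fun z => Φ z - cauchyRep 0 0 ν z) {z | 0 < z.im} :=
    hΦ.sub fun z (hz : 0 < z.im) =>
      (hν.differentiableAt_cauchyRep 0 0 hz.ne').differentiableWithinAt
  obtain ⟨α, c, hαc⟩ := exists_eq_affine_of_im_horizontal hG (g := g) fun x y hy => by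
    rw [Complex.sub_im, hrep x y hy]
    ring
  obtain ⟨hα, hγ⟩ := affine_nonneg (α := α) (γ := c.im) fun y hy => by
    have e := congrArg Complex.im (hαc ⟨0, y⟩ hy)
    rw [Complex.sub_im, hrep 0 y hy] at e
    simp at e
    rw [← e]
    exact hg y hy
  -- Adding `Im c / π` to the weight contributes `i Im c`, the kernel having integral `iπ`.
  have hw := hν.add_const (div_nonneg hγ Real.pi_pos.le)
  have hup : ∀ z : ℂ, 0 < z.im → Φ z = cauchyRep α c.re (fun t => ν t + c.im / Real.pi) z := by
    intro z hz
    rw [cauchyRep, hν.integral_cauchyIntegrand_add_const _ hz]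
    have e := hαc z hz
    rw [cauchyRep] at e
    have hpi : (Real.pi : ℂ) ≠ 0 := by exact_mod_cast Real.pi_ne_zero
    have e2 : ((c.im / Real.pi : ℝ) : ℂ) * (Real.pi * Complex.I) = c.im * Complex.I := by
      push_cast
      field_simp
    rw [e2]
    have e3 := Complex.re_add_im c
    simp only [Complex.ofReal_zero, zero_mul, zero_add] at e
    linear_combination e - e3
  refine ⟨α, c.re, _, hα, hw, fun z hz => ?_⟩
  rcases lt_or_gt_of_ne hz with hz | hz
  · rw [h1.symm z hz, hup (conj z) (by simpa using hz), conj_cauchyRep]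
  · exact hup z hz

end Pick

/-! ### The representation theorem and boundary values, assembled -/

theorem theorem2p2 :
    -- Part 1: the characterization through the first representation
    (∀ Φ : ℂ → ℂ, Φ ∈ primClass ↔
      ∃ (α β : ℝ) (ν : ℝ → ℝ), 0 ≤ α ∧ IsWeight ν ∧
        ∀ z : ℂ, z.im ≠ 0 → Φ z = cauchyRep α β ν z) ∧
    -- the characterization through the second representation
    (∀ Φ : ℂ → ℂ, Φ ∈ primClass ↔
      ReflectionSymmetric Φ ∧
      ∃ (α β : ℝ) (ν : ℝ → ℝ) (hν : IsWeight ν), 0 ≤ α ∧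
        ∀ z : ℂ, 0 < z.im → Φ z = logRep α β ν hν.mono z) ∧
    -- convergence of all the integrals, and equality of the two representations
    (∀ (ν : ℝ → ℝ) (hν : IsWeight ν),
      (∀ z : ℂ, z.im ≠ 0 → Integrable (cauchyIntegrand ν z)) ∧
      IntegrableOn (fun t : ℝ => 1 / t) (Ici 1) (lsMeasure ν hν.mono) ∧
      (∀ z : ℂ, 0 < z.im → Integrable (logIntegrand z) (lsMeasure ν hν.mono)) ∧
      (∀ (α β : ℝ) (z : ℂ), 0 < z.im → cauchyRep α β ν z = logRep α β ν hν.mono z)) ∧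
    -- uniqueness of both representations, up to equality of `ν` almost everywhere
    (∀ (α₁ β₁ α₂ β₂ : ℝ) (ν₁ ν₂ : ℝ → ℝ) (h₁ : IsWeight ν₁) (h₂ : IsWeight ν₂),
      0 ≤ α₁ → 0 ≤ α₂ →
      ((∀ z : ℂ, z.im ≠ 0 → cauchyRep α₁ β₁ ν₁ z = cauchyRep α₂ β₂ ν₂ z) ↔
        α₁ = α₂ ∧ β₁ = β₂ ∧ ν₁ =ᵐ[volume] ν₂) ∧
      ((∀ z : ℂ, 0 < z.im → logRep α₁ β₁ ν₁ h₁.mono z = logRep α₂ β₂ ν₂ h₂.mono z) ↔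
        α₁ = α₂ ∧ β₁ = β₂ ∧ ν₁ =ᵐ[volume] ν₂)) ∧
    -- Part 2: real and imaginary parts and their boundary values
    (∀ (Φ : ℂ → ℂ) (α β : ℝ) (ν : ℝ → ℝ) (hν : IsWeight ν), 0 ≤ α →
      (∀ z : ℂ, z.im ≠ 0 → Φ z = cauchyRep α β ν z) →
      (∀ x y : ℝ, 0 < y →
        (Integrable (fun t : ℝ =>
            ((t - x) / (y ^ 2 + (x - t) ^ 2) - t / (1 + t ^ 2)) * ν t) ∧
          (Φ ⟨x, y⟩).re = α * x + β +
            ∫ t : ℝ, ((t - x) / (y ^ 2 + (x - t) ^ 2) - t / (1 + t ^ 2)) * ν t) ∧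
        (Integrable (fun t : ℝ =>
            Real.log (Real.sqrt ((1 + t ^ 2) / (y ^ 2 + (t - x) ^ 2)))) (lsMeasure ν hν.mono) ∧
          (Φ ⟨x, y⟩).re = α * x + β +
            ∫ t : ℝ, Real.log (Real.sqrt ((1 + t ^ 2) / (y ^ 2 + (t - x) ^ 2)))
              ∂(lsMeasure ν hν.mono)) ∧
        (Integrable (fun t : ℝ => y / (y ^ 2 + (x - t) ^ 2) * ν t) ∧
          (Φ ⟨x, y⟩).im = α * y + ∫ t : ℝ, y / (y ^ 2 + (x - t) ^ 2) * ν t) ∧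
        (Integrable (fun t : ℝ => Real.pi / 2 - Real.arctan ((t - x) / y))
            (lsMeasure ν hν.mono) ∧
          (Φ ⟨x, y⟩).im = α * y + Real.pi * negInf ν +
            ∫ t : ℝ, (Real.pi / 2 - Real.arctan ((t - x) / y)) ∂(lsMeasure ν hν.mono))) ∧
      -- the point `x` carries no mass, so that the value of the integrand at `t = x` is immaterial
      (∀ᵐ x : ℝ, lsMeasure ν hν.mono {x} = 0 ∧
        Integrable (fun t : ℝ => Real.log (Real.sqrt (1 + t ^ 2) / |t - x|))
          (lsMeasure ν hν.mono) ∧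
        HasNontangentialLimit (fun z => (Φ z).re) x
          (α * x + β + ∫ t : ℝ, Real.log (Real.sqrt (1 + t ^ 2) / |t - x|)
            ∂(lsMeasure ν hν.mono))) ∧
      (∀ x : ℝ, ∃ l : ℝ, Tendsto (fun y : ℝ => (Φ ⟨x, y⟩).im) (𝓝[>] 0) (𝓝 l)) ∧
      (IsMidpointNormalized ν →
        ∀ x : ℝ, Tendsto (fun y : ℝ => (Φ ⟨x, y⟩).im) (𝓝[>] 0) (𝓝 (Real.pi * ν x))) ∧
      limitSet (fun z => (Φ z).im) ⊆ (jumpSet ν)ᶜ) := by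
  refine ⟨fun Φ => ⟨exists_cauchyRep_of_mem_primClass, ?_⟩, fun Φ => ⟨fun h => ?_, ?_⟩,
    fun ν hν => ?_, fun α₁ β₁ α₂ β₂ ν₁ ν₂ h₁ h₂ _ _ => ⟨⟨fun h => ?_, ?_⟩, ⟨fun h => ?_, ?_⟩⟩,
    fun Φ α β ν hν hα hΦ => ?_⟩
  · rintro ⟨α, β, ν, hα, hν, h⟩
    exact mem_primClass_of_cauchyRep hα hν h
  · obtain ⟨α, β, ν, hα, hν, hrep⟩ := exists_cauchyRep_of_mem_primClass h
    exact ⟨h.1.symm, α, β, ν, hν, hα, fun z hz => by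
      rw [hrep z hz.ne', hν.cauchyRep_eq_logRep α β hz]⟩
  · rintro ⟨hs, α, β, ν, hν, hα, h⟩
    refine mem_primClass_of_cauchyRep (α := α) (β := β) hα hν fun z hz => ?_
    -- The logarithmic form is used only in the upper half-plane; symmetry of `Φ` and of `cauchyRep`
    -- covers the lower one.
    rcases lt_or_gt_of_ne hz with hz | hz
    · have hz' : 0 < (conj z).im := by simpa using hz
      rw [hs z hz, h _ hz', ← hν.cauchyRep_eq_logRep α β hz', conj_cauchyRep]
    · rw [h z hz, hν.cauchyRep_eq_logRep α β hz]
  · refine ⟨fun z hz => hν.integrable_cauchyIntegrand hz, ?_,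
      fun z hz => hν.integrable_logIntegrand hz.ne',
      fun α β z hz => hν.cauchyRep_eq_logRep α β hz⟩
    simpa only [sub_zero, zero_add] using hν.integrableOn_inv_sub 0
  · exact h₁.ext_of_cauchyRep h₂ fun z hz => h z hz.ne'
  · rintro ⟨rfl, rfl, h⟩ z -
    exact cauchyRep_congr h z
  · refine h₁.ext_of_cauchyRep h₂ fun z hz => ?_
    rw [h₁.cauchyRep_eq_logRep α₁ β₁ hz, h₂.cauchyRep_eq_logRep α₂ β₂ hz, h z hz]
  · rintro ⟨rfl, rfl, h⟩ z hz
    rw [← h₁.cauchyRep_eq_logRep α₁ β₁ hz, ← h₂.cauchyRep_eq_logRep α₁ β₁ hz, cauchyRep_congr h]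
  · have himeq : ∀ x y : ℝ, 0 < y → (Φ ⟨x, y⟩).im = (cauchyRep α β ν ⟨x, y⟩).im :=
      fun x y hy => by rw [hΦ ⟨x, y⟩ hy.ne']
    have hvert : ∀ x : ℝ, Tendsto (fun y : ℝ => (Φ ⟨x, y⟩).im) (𝓝[>] 0)
        (𝓝 (Real.pi * ((Function.rightLim ν x + Function.leftLim ν x) / 2))) := fun x =>
      (hν.tendsto_im_vertical α β x).congr' (by
        filter_upwards [self_mem_nhdsWithin] with y hy using (himeq x y hy).symm)
    have hev : ∀ x k : ℝ, ∀ᶠ z in 𝓝[stolzCone x k] (x : ℂ), cauchyRep α β ν z = Φ z := fun x k => by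
      filter_upwards [self_mem_nhdsWithin] with z hz using (hΦ z hz.1.ne').symm
    refine ⟨fun x y hy => ?_, ?_, fun x => ⟨_, hvert x⟩, fun hmid x => ?_, ?_⟩
    · rw [hΦ ⟨x, y⟩ hy.ne']
      exact ⟨hν.re_cauchy α β x hy.ne', hν.re_log α β x hy, hν.im_cauchy α β x hy.ne',
        hν.im_log α β x hy⟩
    · filter_upwards [ae_lsMeasure_singleton_eq_zero hν.mono,
        ae_integrableOn_log_ball (lsMeasure ν hν.mono)] with x hx0 hx
      obtain ⟨h1, h2⟩ := hν.nontangential_re α β hx0 hx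
      exact ⟨hx0, h1, fun k hk => (h2 k hk).congr'
        ((hev x k).mono fun z hz => congrArg Complex.re hz)⟩
    · rw [hmid x]
      exact hvert x
    · rintro x ⟨l, hl⟩
      exact hν.limitSet_im_subset α β ⟨l, fun k hk => (hl k hk).congr'
        ((hev x k).mono fun z hz => congrArg Complex.im hz.symm)⟩
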